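/- Let $E$ be a Hermite--Biehler function without real zeros, i.e. $E$ is entire, $|E(z)|>|E^*(z)|$ for $\operatorname{Im} z>0$, where $E^*(z)=\overline{E(\bar z)}$, and $E(x)\neq 0$ for $x\in\mathbb R$. Let $H(E)$ be the de Branges space of all entire functions $f$ such that $f/E$ and $f^*/E$ belong to the Hardy space $H^2(\mathbb C_+)$ of the upper half-plane, with inner product $\langle f,g\rangle=\int_{\mathbb R} f(x)\overline{g(x)}\,|E(x)|^{-2}\,dx$. Let $\phi:\mathbb R\to\mathbb R$ be a phase function of $E$, i.e. a continuous function with $E(x)=|E(x)|e^{-i\phi(x)}$ for $x\in\mathbb R$ (such a function is automatically $C^\infty$ with $\phi'>0$), and let $$S\phi=\Big(\frac{\phi''}{\phi'}\Big)'-\frac12\Big(\frac{\phi''}{\phi'}\Big)^2$$ be its Schwarzian derivative. For $\omega\in\mathbb R$ let $k_\omega=K_\omega/\|K_\omega\|$ be the normalized reproducing kernel of $H(E)$ at $\omega$, where $K_\omega\in H(E)$ is determined by $f(\omega)=\langle f,K_\omega\rangle$ for all $f\in H(E)$. If $\{\omega_n\}$ is a (finite or infinite) family of real points such that $\{k_{\omega_n}\}$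 is an orthonormal basis of $H(E)$, then for every index $k$ $$\sum_{n\neq k}\frac{\phi'(\omega_k)}{(\omega_k-\omega_n)^2\,\phi'(\omega_n)}=\frac{\phi'(\omega_k)^2}{3}+\frac{S\phi(\omega_k)}{6},$$ the series being convergent. -/

import Mathlib

open MeasureTheory Filter Topology
open scoped ENNReal NNReal ComplexConjugate InnerProductSpace

noncomputable section

/-- The function `f*(z) = conj (f (conj z))`. -/
def sharp (f : ℂ → ℂ) : ℂ → ℂ := fun z => conj (f (conj z))

/-- Membership in the Hardy space `H²` of the upper half-plane: `F` is holomorphic there, and its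
`L²` norms along the horizontal lines `Im z = y`, `y > 0`, are bounded. -/
def MemHardyTwo (F : ℂ → ℂ) : Prop :=
  DifferentiableOn ℂ F {z : ℂ | 0 < z.im} ∧
    ∃ C : ℝ≥0, ∀ y : ℝ, 0 < y →
      ∫⁻ x : ℝ, ‖F ((x : ℂ) + (y : ℂ) * Complex.I)‖ₑ ^ 2 ≤ (C : ℝ≥0∞)

/-- Entire functions of the Hermite-Biehler class without real zeros. -/
structure HermiteBiehler where
  toFun : ℂ → ℂ
  differentiable' : Differentiable ℂ toFun
  norm_sharp_lt' : ∀ z : ℂ, 0 < z.im → ‖sharp toFun z‖ < ‖toFun z‖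
  ne_zero_real' : ∀ x : ℝ, toFun (x : ℂ) ≠ 0

instance : CoeFun HermiteBiehler (fun _ => ℂ → ℂ) := ⟨HermiteBiehler.toFun⟩

theorem HermiteBiehler.ne_zero_of_im_nonneg (E : HermiteBiehler) {z : ℂ} (hz : 0 ≤ z.im) :
    E z ≠ 0 := by
  rcases hz.eq_or_lt with h | h
  · have : z = ((z.re : ℝ) : ℂ) := Complex.ext (by simp) (by simp [← h])
    rw [this]
    exact E.ne_zero_real' _
  · intro h0
    have := E.norm_sharp_lt' z h
    rw [h0, norm_zero] at this
    exact absurd this (not_lt.mpr (norm_nonneg _))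

theorem memHardyTwo_zero : MemHardyTwo (fun _ => 0) :=
  ⟨differentiableOn_const _, 0, by simp⟩

theorem MemHardyTwo.add {F G : ℂ → ℂ} (hF : MemHardyTwo F) (hG : MemHardyTwo G) :
    MemHardyTwo (fun z => F z + G z) := by
  obtain ⟨hF1, C, hC⟩ := hF
  obtain ⟨hG1, D, hD⟩ := hG
  refine ⟨hF1.add hG1, 2 * (C + D), fun y hy => ?_⟩
  have hmeas : ∀ H : ℂ → ℂ, DifferentiableOn ℂ H {z : ℂ | 0 < z.im} →
      Measurable fun x : ℝ => ‖H ((x : ℂ) + (y : ℂ) * Complex.I)‖ₑ ^ 2 := by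
    intro H hH
    have hc : Continuous fun x : ℝ => H ((x : ℂ) + (y : ℂ) * Complex.I) :=
      hH.continuousOn.comp_continuous (by fun_prop) (fun x => by simpa using hy)
    exact (hc.measurable.enorm).pow_const 2
  calc ∫⁻ x : ℝ, ‖F ((x : ℂ) + (y : ℂ) * Complex.I) + G ((x : ℂ) + (y : ℂ) * Complex.I)‖ₑ ^ 2
      ≤ ∫⁻ x : ℝ, 2 * (‖F ((x : ℂ) + (y : ℂ) * Complex.I)‖ₑ ^ 2
          + ‖G ((x : ℂ) + (y : ℂ) * Complex.I)‖ₑ ^ 2) := by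
        refine lintegral_mono fun x => ?_
        have h1 : ∀ a b : ℂ, ‖a + b‖ₑ ^ 2 ≤ 2 * (‖a‖ₑ ^ 2 + ‖b‖ₑ ^ 2) := by
          intro a b
          have h2 : ‖a + b‖₊ ^ 2 ≤ 2 * (‖a‖₊ ^ 2 + ‖b‖₊ ^ 2) := by
            rw [← NNReal.coe_le_coe]
            push_cast
            nlinarith [norm_add_le a b, norm_nonneg (a + b), sq_nonneg (‖a‖ - ‖b‖),
              norm_nonneg a, norm_nonneg b]
          simp only [enorm_eq_nnnorm]
          exact_mod_cast h2
        exact h1 _ _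
    _ = 2 * ((∫⁻ x : ℝ, ‖F ((x : ℂ) + (y : ℂ) * Complex.I)‖ₑ ^ 2)
          + ∫⁻ x : ℝ, ‖G ((x : ℂ) + (y : ℂ) * Complex.I)‖ₑ ^ 2) := by
        rw [lintegral_const_mul' _ _ (by simp), lintegral_add_left (hmeas F hF1)]
    _ ≤ 2 * ((C : ℝ≥0∞) + D) := by gcongr <;> [exact hC y hy; exact hD y hy]
    _ = ((2 * (C + D) : ℝ≥0) : ℝ≥0∞) := by push_cast; rfl

theorem MemHardyTwo.const_mul {F : ℂ → ℂ} (hF : MemHardyTwo F) (c : ℂ) :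
    MemHardyTwo (fun z => c * F z) := by
  obtain ⟨hF1, C, hC⟩ := hF
  refine ⟨hF1.const_mul c, ‖c‖₊ ^ 2 * C, fun y hy => ?_⟩
  simp only [enorm_mul, mul_pow]
  rw [lintegral_const_mul' _ _ (by simp [enorm_eq_nnnorm])]
  push_cast
  rw [enorm_eq_nnnorm]
  gcongr
  exact hC y hy

/-- The vector space underlying `H(E)`: the entire functions `f` with `f / E` and `f* / E` in the
Hardy space `H²` of the upper half-plane. -/
def deBrangesSubmodule (E : HermiteBiehler) : Submodule ℂ (ℂ → ℂ) where
  carrier := {f | Differentiable ℂ f ∧ MemHardyTwo (fun z => f z / E z) ∧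
    MemHardyTwo (fun z => sharp f z / E z)}
  zero_mem' := ⟨differentiable_const _, by simpa using memHardyTwo_zero,
    by simpa [sharp] using memHardyTwo_zero⟩
  add_mem' := by
    rintro f g ⟨hf, hf1, hf2⟩ ⟨hg, hg1, hg2⟩
    refine ⟨hf.add hg, ?_, ?_⟩
    · simpa [add_div] using hf1.add hg1
    · simpa [sharp, add_div] using hf2.add hg2
  smul_mem' := by
    rintro c f ⟨hf, hf1, hf2⟩
    refine ⟨hf.const_smul c, ?_, ?_⟩
    · simpa [mul_div_assoc] using hf1.const_mul c
    · simpa [sharp, mul_div_assoc] using hf2.const_mul (conj c)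

/-- The de Branges space `H(E)`. It is a type of its own, so that its topology is that of the
norm below and not the topology of pointwise convergence. -/
def DeBranges (E : HermiteBiehler) : Type := deBrangesSubmodule E

namespace DeBranges

variable {E : HermiteBiehler}

instance : AddCommGroup (DeBranges E) := inferInstanceAs (AddCommGroup (deBrangesSubmodule E))

instance : Module ℂ (DeBranges E) := inferInstanceAs (Module ℂ (deBrangesSubmodule E))

/-- An element of `H(E)` as an entire function. -/
def toFun (f : DeBranges E) : ℂ → ℂ := Subtype.val f

instance : CoeFun (DeBranges E) (fun _ => ℂ → ℂ) := ⟨toFun⟩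

theorem ext {f g : DeBranges E} (h : ∀ z, f z = g z) : f = g := Subtype.ext (funext h)

@[simp] theorem add_apply (f g : DeBranges E) (z : ℂ) : (f + g) z = f z + g z := rfl

@[simp] theorem smul_apply (c : ℂ) (f : DeBranges E) (z : ℂ) : (c • f) z = c * f z := rfl

@[simp] theorem zero_apply (z : ℂ) : (0 : DeBranges E) z = 0 := rfl

theorem differentiable (f : DeBranges E) : Differentiable ℂ f := (Subtype.property f).1

theorem continuous_quotient (f : DeBranges E) :
    Continuous fun x : ℝ => f (x : ℂ) / E (x : ℂ) :=
  (f.differentiable.continuous.comp Complex.continuous_ofReal).div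
    (E.differentiable'.continuous.comp Complex.continuous_ofReal) E.ne_zero_real'

/-- The restriction of `f / E` to the real line is square integrable. -/
theorem memLp_quotient (f : DeBranges E) :
    MemLp (fun x : ℝ => f (x : ℂ) / E (x : ℂ)) 2 volume := by
  refine ⟨f.continuous_quotient.aestronglyMeasurable, ?_⟩
  rw [eLpNorm_lt_top_iff_lintegral_rpow_enorm_lt_top (by norm_num) (by norm_num)]
  obtain ⟨hd, C, hC⟩ := (Subtype.property f).2.1
  have hlim : ∀ x : ℝ, Tendsto (fun n : ℕ => ‖f ((x : ℂ) + ((1 / ((n : ℝ) + 1) : ℝ) : ℂ) * Complex.I)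
      / E ((x : ℂ) + ((1 / ((n : ℝ) + 1) : ℝ) : ℂ) * Complex.I)‖ₑ ^ 2) atTop
      (𝓝 (‖f (x : ℂ) / E (x : ℂ)‖ₑ ^ 2)) := by
    intro x
    have hc : ContinuousAt (fun z : ℂ => f z / E z) (x : ℂ) :=
      f.differentiable.continuous.continuousAt.div
        E.differentiable'.continuous.continuousAt (E.ne_zero_real' x)
    have ht : Tendsto (fun n : ℕ => (x : ℂ) + ((1 / ((n : ℝ) + 1) : ℝ) : ℂ) * Complex.I) atTop
        (𝓝 (x : ℂ)) := by
      have h0 : Tendsto (fun n : ℕ => ((1 / ((n : ℝ) + 1) : ℝ) : ℂ)) atTop (𝓝 ((0 : ℝ) : ℂ)) :=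
        (Complex.continuous_ofReal.tendsto 0).comp tendsto_one_div_add_atTop_nhds_zero_nat
      simpa using (h0.mul_const Complex.I).const_add (x : ℂ)
    have h3 := (hc.tendsto.comp ht).enorm
    exact ((ENNReal.continuous_pow 2).tendsto _).comp h3
  have hmeas : ∀ n : ℕ, Measurable fun x : ℝ =>
      ‖f ((x : ℂ) + ((1 / ((n : ℝ) + 1) : ℝ) : ℂ) * Complex.I)
      / E ((x : ℂ) + ((1 / ((n : ℝ) + 1) : ℝ) : ℂ) * Complex.I)‖ₑ ^ 2 := by
    intro n
    have h1 := f.differentiable.continuous.measurable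
    have h2 := E.differentiable'.continuous.measurable
    fun_prop
  have key : ∫⁻ x : ℝ, ‖f (x : ℂ) / E (x : ℂ)‖ₑ ^ 2 ≤ C := by
    calc ∫⁻ x : ℝ, ‖f (x : ℂ) / E (x : ℂ)‖ₑ ^ 2
        = ∫⁻ x : ℝ, liminf (fun n : ℕ =>
            ‖f ((x : ℂ) + ((1 / ((n : ℝ) + 1) : ℝ) : ℂ) * Complex.I)
            / E ((x : ℂ) + ((1 / ((n : ℝ) + 1) : ℝ) : ℂ) * Complex.I)‖ₑ ^ 2) atTop :=
          lintegral_congr fun x => (hlim x).liminf_eq.symm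
      _ ≤ liminf (fun n : ℕ => ∫⁻ x : ℝ,
            ‖f ((x : ℂ) + ((1 / ((n : ℝ) + 1) : ℝ) : ℂ) * Complex.I)
            / E ((x : ℂ) + ((1 / ((n : ℝ) + 1) : ℝ) : ℂ) * Complex.I)‖ₑ ^ 2) atTop :=
          lintegral_liminf_le hmeas
      _ ≤ C := by
          refine liminf_le_of_frequently_le' (Frequently.of_forall fun n => ?_)
          exact hC _ (by positivity)
  refine lt_of_le_of_lt (le_of_eq ?_) (key.trans_lt ENNReal.coe_lt_top)
  refine lintegral_congr fun x => ?_
  norm_num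

/-- The inner product of `H(E)`, conjugate linear in the first variable:
`∫ conj (f x) * g x / |E x|² dx` over the real line. -/
def innerProd (f g : DeBranges E) : ℂ :=
  ∫ x : ℝ, conj (f (x : ℂ)) * g (x : ℂ) / ((‖E (x : ℂ)‖ ^ 2 : ℝ) : ℂ)

theorem integrand_eq (f g : DeBranges E) (x : ℝ) :
    conj (f (x : ℂ)) * g (x : ℂ) / ((‖E (x : ℂ)‖ ^ 2 : ℝ) : ℂ) =
      conj (f (x : ℂ) / E (x : ℂ)) * (g (x : ℂ) / E (x : ℂ)) := by
  have h : ((‖E (x : ℂ)‖ ^ 2 : ℝ) : ℂ) = conj (E (x : ℂ)) * E (x : ℂ) := by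
    rw [Complex.conj_mul']; push_cast; rfl
  rw [h, map_div₀, div_mul_div_comm]

theorem integrable_integrand (f g : DeBranges E) :
    Integrable fun x : ℝ => conj (f (x : ℂ)) * g (x : ℂ) / ((‖E (x : ℂ)‖ ^ 2 : ℝ) : ℂ) := by
  simp only [integrand_eq]
  exact f.memLp_quotient.star.integrable_mul g.memLp_quotient

theorem integrand_self (f : DeBranges E) (x : ℝ) :
    conj (f (x : ℂ)) * f (x : ℂ) / ((‖E (x : ℂ)‖ ^ 2 : ℝ) : ℂ) =
      ((‖f (x : ℂ) / E (x : ℂ)‖ ^ 2 : ℝ) : ℂ) := by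
  rw [integrand_eq, Complex.conj_mul']; push_cast; rfl

theorem innerProd_self_eq (f : DeBranges E) :
    innerProd f f = ((∫ x : ℝ, ‖f (x : ℂ) / E (x : ℂ)‖ ^ 2 : ℝ) : ℂ) := by
  rw [innerProd, ← integral_complex_ofReal]
  exact integral_congr_ae (Eventually.of_forall fun x => integrand_self f x)

/-- An element of `H(E)` of norm zero vanishes identically. -/
theorem eq_zero_of_innerProd_self (f : DeBranges E) (h : innerProd f f = 0) : f = 0 := by
  rw [innerProd_self_eq] at h
  have h1 : ∫ x : ℝ, ‖f (x : ℂ) / E (x : ℂ)‖ ^ 2 = 0 := by exact_mod_cast h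
  rw [integral_eq_zero_iff_of_nonneg (fun x => by positivity)
    (f.memLp_quotient.integrable_norm_pow (by norm_num))] at h1
  have h2 := (Continuous.ae_eq_iff_eq volume (f.continuous_quotient.norm.pow 2)
    continuous_const).1 h1
  have h3 : ∀ x : ℝ, f (x : ℂ) = 0 := by
    intro x
    have h5 : ‖f (x : ℂ) / E (x : ℂ)‖ ^ 2 = (0 : ℝ) := congrFun h2 x
    have h6 := norm_eq_zero.1 (pow_eq_zero_iff two_ne_zero |>.1 h5)
    exact (div_eq_zero_iff.1 h6).resolve_right (E.ne_zero_real' x)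
  have h4 : Set.EqOn f.toFun 0 Set.univ := by
    refine AnalyticOnNhd.eqOn_zero_of_preconnected_of_frequently_eq_zero (z₀ := 0)
      (fun z _ => f.differentiable.analyticAt z) isPreconnected_univ (Set.mem_univ _) ?_
    have ht : Tendsto (fun n : ℕ => ((1 / ((n : ℝ) + 1) : ℝ) : ℂ)) atTop (𝓝[≠] 0) := by
      refine tendsto_nhdsWithin_iff.2 ⟨?_, Eventually.of_forall fun n => ?_⟩
      · have := (Complex.continuous_ofReal.tendsto 0).comp
          (tendsto_one_div_add_atTop_nhds_zero_nat (𝕜 := ℝ))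
        simpa [Function.comp_def] using this
      · have : (1 / ((n : ℝ) + 1) : ℝ) ≠ 0 := by positivity
        exact Complex.ofReal_ne_zero.2 this
    exact ht.frequently (Frequently.of_forall fun n => h3 _)
  exact ext fun z => h4 (Set.mem_univ z)

/-- `H(E)` with its inner product. -/
@[reducible] def core (E : HermiteBiehler) : InnerProductSpace.Core ℂ (DeBranges E) where
  inner f g := innerProd f g
  conj_inner_symm f g := by
    simp only [innerProd]
    rw [← integral_conj]
    refine integral_congr_ae (Eventually.of_forall fun x => ?_)
    simp only [map_div₀, map_mul, Complex.conj_conj, Complex.conj_ofReal]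
    ring
  re_inner_nonneg f := by
    rw [innerProd_self_eq]
    exact integral_nonneg fun x => by positivity
  add_left f g h := by
    simp only [innerProd]
    rw [← integral_add (integrable_integrand f h) (integrable_integrand g h)]
    refine integral_congr_ae (Eventually.of_forall fun x => ?_)
    simp only [add_apply, map_add]
    ring
  smul_left f g c := by
    simp only [innerProd]
    rw [← integral_const_mul]
    refine integral_congr_ae (Eventually.of_forall fun x => ?_)
    simp only [smul_apply, map_mul]
    ring
  definite f h := eq_zero_of_innerProd_self f h

instance : NormedAddCommGroup (DeBranges E) := (core E).toNormedAddCommGroup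

instance : InnerProductSpace ℂ (DeBranges E) := InnerProductSpace.ofCore (core E).toCore

theorem inner_eq (f g : DeBranges E) :
    ⟪f, g⟫_ℂ = ∫ x : ℝ, conj (f (x : ℂ)) * g (x : ℂ) / ((‖E (x : ℂ)‖ ^ 2 : ℝ) : ℂ) := rfl

/-- The norm of `H(E)`: `‖f‖² = ∫ |f x / E x|² dx` over the real line. -/
theorem norm_sq_eq (f : DeBranges E) :
    ‖f‖ ^ 2 = ∫ x : ℝ, ‖f (x : ℂ) / E (x : ℂ)‖ ^ 2 := by
  have h : ⟪f, f⟫_ℂ = ((‖f‖ ^ 2 : ℝ) : ℂ) := by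
    rw [inner_self_eq_norm_sq_to_K (𝕜 := ℂ) f]; push_cast; rfl
  have h' : ((‖f‖ ^ 2 : ℝ) : ℂ) = ((∫ x : ℝ, ‖f (x : ℂ) / E (x : ℂ)‖ ^ 2 : ℝ) : ℂ) :=
    h.symm.trans (innerProd_self_eq f)
  exact_mod_cast h'

/-- `K` is the reproducing kernel of `H(E)` at the point `w`: `f w = ∫ f conj(K) / |E|²` for all
`f` in `H(E)`. There is at most one such `K`. -/
def IsReproducingKernel (w : ℂ) (K : DeBranges E) : Prop :=
  ∀ f : DeBranges E, f w = ⟪K, f⟫_ℂ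

/-- `k` is the normalized reproducing kernel of `H(E)` at `w`, that is `k = K / ‖K‖`. -/
def IsNormalizedKernel (w : ℂ) (k : DeBranges E) : Prop :=
  ∃ K : DeBranges E, IsReproducingKernel w K ∧ k = ((‖K‖⁻¹ : ℝ) : ℂ) • K

/-- The normalized reproducing kernels of `H(E)` at the real points `ω n` form an orthonormal
basis of `H(E)`: they are orthonormal and their linear span is dense. -/
def IsKernelBasis (E : HermiteBiehler) {ι : Type*} (ω : ι → ℝ) : Prop :=
  ∃ k : ι → DeBranges E, (∀ n, IsNormalizedKernel (ω n : ℂ) (k n)) ∧ Orthonormal ℂ k ∧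
    (Submodule.span ℂ (Set.range k)).topologicalClosure = ⊤

end DeBranges

/-- `φ` is a phase function of `E`: it is continuous and `E x = |E x| exp (-i φ x)` on the real
line. It is unique up to an additive constant in `2πℤ`. -/
def IsPhaseFunction (E : HermiteBiehler) (φ : ℝ → ℝ) : Prop :=
  Continuous φ ∧
    ∀ x : ℝ, E (x : ℂ) = (‖E (x : ℂ)‖ : ℂ) * Complex.exp (-(Complex.I * (φ x : ℂ)))

/-- The Schwarzian derivative `(φ''/φ')' - (φ''/φ')² / 2`. -/
def schwarzian (φ : ℝ → ℝ) (x : ℝ) : ℝ :=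
  deriv (fun t => deriv (deriv φ) t / deriv φ t) x - (deriv (deriv φ) x / deriv φ x) ^ 2 / 2

end

/-! Everything rests on an explicit reproducing kernel at real points: for real `t ≠ x`, `K_x(t) =
|E(x)| |E(t)| sin(φ(t) - φ(x)) / (π (t - x))`, and `t → x` gives `‖K_x‖² = |E(x)|² φ'(x) / π`, hence
`φ' > 0`. Orthogonality of the kernels at the nodes `ω n` makes the phases `φ(ω n)` congruent modulo
`π`, so `sin²(φ(ω n) - φ(x))` does not depend on `n`. Parseval's identity for `K_x` then becomes `∑ₙ
1 / ((x - ω n)² φ'(ω n)) = φ'(x) / sin²(φ(x) - φ(ω k))`. Move the singular term `n = k` to the right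
and let `x → ω k`. The left side converges by domination; on the right, a third order Taylor
expansion (`tendsto_deriv_div_sin_sq_sub`) gives `φ'/3 + Sφ/(6φ')`. Multiplying by `φ'(ω k)` yields
the formula.

The analytic cost lies in proving that `K_x` reproduces when the Hardy space is defined only by
bounded means on horizontal lines. The tool is a Cauchy theorem for the half-plane
(`MemHardyTwo.integral_dslope_eq_zero`), applied to `f / E` and `f* / E` after a Cauchy kernel has
been subtracted to remove the pole at `x`. -/

/-! ### Cauchy's theorem in the Hardy space of the half-plane -/

theorem enorm_dslope_le {H : ℂ → ℂ} {a z : ℂ} (hz : z ≠ a) (h0 : H a = 0) {s : ℝ} (hs : 0 < s) :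
    ‖dslope H a z‖ₑ ≤
      ENNReal.ofReal s⁻¹ * ‖H z‖ₑ ^ 2 + ENNReal.ofReal (s / ‖z - a‖ ^ 2) := by
  have hp : 0 < ‖z - a‖ := norm_pos_iff.2 (sub_ne_zero.2 hz)
  rw [dslope_of_ne _ hz, slope_def_field, h0, sub_zero, ← ofReal_norm,
    ← ofReal_norm, ← ENNReal.ofReal_pow (norm_nonneg _),
    ← ENNReal.ofReal_mul (by positivity), ← ENNReal.ofReal_add (by positivity) (by positivity)]
  refine ENNReal.ofReal_le_ofReal ?_
  rw [norm_div]
  have h := two_mul_le_add_sq (‖H z‖ * s⁻¹) (1 / ‖z - a‖)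
  have h2 : ‖H z‖ / ‖z - a‖ = s * ((‖H z‖ * s⁻¹) * (1 / ‖z - a‖)) := by field_simp
  have h3 : s⁻¹ * ‖H z‖ ^ 2 + s / ‖z - a‖ ^ 2 =
      s * ((‖H z‖ * s⁻¹) ^ 2 + (1 / ‖z - a‖) ^ 2) := by field_simp
  rw [h2, h3]
  refine mul_le_mul_of_nonneg_left ?_ hs.le
  have : 0 ≤ (‖H z‖ * s⁻¹) * (1 / ‖z - a‖) := by positivity
  linarith

theorem continuousOn_dslope_of_differentiableAt {H : ℂ → ℂ} {a : ℂ} {S : Set ℂ}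
    (hc : ContinuousOn H S) (hd : DifferentiableAt ℂ H a) : ContinuousOn (dslope H a) S := by
  intro z hz
  by_cases h : z = a
  · subst h
    exact (continuousAt_dslope_same.2 hd).continuousWithinAt
  · exact (continuousWithinAt_dslope_of_ne h).2 (hc z hz)

theorem integrable_inv_one_add_sub_sq (x : ℝ) : Integrable fun t : ℝ => (1 + (t - x) ^ 2)⁻¹ :=
  integrable_inv_one_add_sq.comp_sub_right x

theorem integrable_dslope {H : ℂ → ℂ} {x : ℝ} (hc : ContinuousOn H {z : ℂ | 0 ≤ z.im})
    (hd : DifferentiableAt ℂ H x) (h0 : H x = 0) (hL : MemLp (fun t : ℝ => H t) 2) :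
    Integrable fun t : ℝ => dslope H x t := by
  have hcd : Continuous fun t : ℝ => dslope H x t :=
    (continuousOn_dslope_of_differentiableAt hc hd).comp_continuous
      Complex.continuous_ofReal fun t => by simp
  obtain ⟨M, hM⟩ := (isCompact_Icc (a := x - 1) (b := x + 1)).exists_bound_of_continuousOn
    hcd.continuousOn
  have hM0 : 0 ≤ M := (norm_nonneg _).trans (hM x ⟨by linarith, by linarith⟩)
  -- Write `u = t - x`. Where `u² ≤ 1`, compactness gives the bound `M ≤ 2M / (1 + u²)`; elsewhere
  -- the quotient is at most `|H|² + 1/u²`, and `1/u² ≤ 2 / (1 + u²)`.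
  refine Integrable.mono' (g := fun t : ℝ => ‖H t‖ ^ 2 + (2 + 2 * M) * (1 + (t - x) ^ 2)⁻¹)
    ((hL.integrable_norm_pow (by norm_num)).add
      ((integrable_inv_one_add_sub_sq x).const_mul _)) hcd.aestronglyMeasurable
    (Eventually.of_forall fun t => ?_)
  have hpos : 0 < 1 + (t - x) ^ 2 := by positivity
  by_cases ht : t ∈ Set.Icc (x - 1) (x + 1)
  · have h1 := hM t ht
    have h2 : (t - x) ^ 2 ≤ 1 := by
      have := ht.1
      have := ht.2
      nlinarith
    have h3 : M ≤ (2 + 2 * M) * (1 + (t - x) ^ 2)⁻¹ := by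
      rw [← div_eq_mul_inv, le_div_iff₀ hpos]
      nlinarith
    have : 0 ≤ ‖H t‖ ^ 2 := by positivity
    linarith
  · have h1 : 1 ≤ (t - x) ^ 2 := by
      rw [Set.mem_Icc, not_and_or, not_le, not_le] at ht
      rcases ht with h | h <;> nlinarith
    have hne : (t : ℂ) ≠ x := by
      intro h
      rw [Complex.ofReal_inj.1 h] at h1
      norm_num at h1
    have h2 := enorm_dslope_le hne h0 one_pos
    have h3 : ‖(t : ℂ) - x‖ ^ 2 = (t - x) ^ 2 := by
      rw [← Complex.ofReal_sub, Complex.norm_real, Real.norm_eq_abs, sq_abs]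
    rw [h3, ← ofReal_norm, ← ofReal_norm, ← ENNReal.ofReal_pow (norm_nonneg _),
      ← ENNReal.ofReal_mul (by positivity), ← ENNReal.ofReal_add (by positivity) (by positivity),
      ENNReal.ofReal_le_ofReal_iff (by positivity)] at h2
    refine h2.trans ?_
    rw [inv_one, one_mul]
    gcongr
    rw [← div_eq_mul_inv, div_le_div_iff₀ (by positivity) hpos]
    nlinarith

/-- An integrable function need not tend to zero, but it cannot stay above `ε` on a half-line. This
supplies arbitrarily large `R` for which both vertical sides of the contour are small. -/
theorem frequently_add_neg_lt {G : ℝ → ℝ≥0∞} (hG : Measurable G) (hfin : ∫⁻ t, G t ≠ ∞)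
    {ε : ℝ≥0∞} (hε : ε ≠ 0) : ∃ᶠ R in atTop, G R + G (-R) < ε := by
  intro h
  simp only [not_lt] at h
  obtain ⟨R₀, hR₀⟩ := eventually_atTop.1 h
  have h1 : ∫⁻ t, (G t + G (-t)) ≠ ∞ := by
    rw [lintegral_add_left hG, lintegral_neg_eq_self]
    exact ENNReal.add_ne_top.2 ⟨hfin, hfin⟩
  refine h1 (top_le_iff.1 ?_)
  calc (∞ : ℝ≥0∞) = ∫⁻ _ in Set.Ici R₀, ε := by simp [ENNReal.mul_top hε]
    _ ≤ ∫⁻ t in Set.Ici R₀, (G t + G (-t)) :=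
      setLIntegral_mono' measurableSet_Ici fun t ht => hR₀ t ht
    _ ≤ _ := setLIntegral_le_lintegral _ _

theorem integral_div_sub_sq_add (x : ℝ) {s : ℝ} (hs : 0 < s) :
    Integrable (fun t : ℝ => s / ((t - x) ^ 2 + (s ^ 2) ^ 2)) ∧
      ∫ t : ℝ, s / ((t - x) ^ 2 + (s ^ 2) ^ 2) = Real.pi / s := by
  have he : (fun t : ℝ => s / ((t - x) ^ 2 + (s ^ 2) ^ 2)) =
      fun t : ℝ => (s ^ 3)⁻¹ * (1 + ((t - x) / s ^ 2) ^ 2)⁻¹ := by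
    ext t
    have : (t - x) ^ 2 + (s ^ 2) ^ 2 ≠ 0 := by positivity
    have h2 : s ^ 4 + (t - x) ^ 2 ≠ 0 := by positivity
    field_simp
    ring
  rw [he]
  constructor
  · exact ((integrable_inv_one_add_sq.comp_div (by positivity : s ^ 2 ≠ 0)).comp_sub_right
      x).const_mul _
  · rw [integral_const_mul, integral_sub_right_eq_self (fun t => (1 + (t / s ^ 2) ^ 2)⁻¹) x,
      Measure.integral_comp_div (fun t => (1 + t ^ 2)⁻¹), integral_univ_inv_one_add_sq,
      abs_of_pos (by positivity), smul_eq_mul]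
    field_simp

/-- The weight `s` in the arithmetic-geometric inequality is matched to the height `s²`: both the
Hardy term and the integral of `s / |z - x|²` are then of order `1/s`, so the top side of the
contour disappears as `s → ∞`. -/
theorem lintegral_enorm_dslope_le {H : ℂ → ℂ} {C : ℝ≥0} {x : ℝ} (h0 : H x = 0) {s : ℝ}
    (hs : 0 < s)
    (hC : ∫⁻ t : ℝ, ‖H ((t : ℂ) + ((s ^ 2 : ℝ) : ℂ) * Complex.I)‖ₑ ^ 2 ≤ (C : ℝ≥0∞)) :
    ∫⁻ t : ℝ, ‖dslope H x ((t : ℂ) + ((s ^ 2 : ℝ) : ℂ) * Complex.I)‖ₑ ≤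
      ENNReal.ofReal s⁻¹ * C + ENNReal.ofReal (Real.pi / s) := by
  obtain ⟨h1, h2⟩ := integral_div_sub_sq_add x hs
  calc _ ≤ ∫⁻ t : ℝ, (ENNReal.ofReal s⁻¹ * ‖H ((t : ℂ) + ((s ^ 2 : ℝ) : ℂ) * Complex.I)‖ₑ ^ 2
        + ENNReal.ofReal (s / ((t - x) ^ 2 + (s ^ 2) ^ 2))) := by
        refine lintegral_mono fun t => ?_
        have hne : (t : ℂ) + ((s ^ 2 : ℝ) : ℂ) * Complex.I ≠ x := by
          intro h
          have := congrArg Complex.im h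
          simp [-Complex.ofReal_pow] at this
          exact hs.ne' this
        have h := enorm_dslope_le hne h0 hs
        have hn : ‖(t : ℂ) + ((s ^ 2 : ℝ) : ℂ) * Complex.I - x‖ ^ 2 =
            (t - x) ^ 2 + (s ^ 2) ^ 2 := by
          rw [Complex.sq_norm, Complex.normSq_apply]
          simp [-Complex.ofReal_pow]
          ring
        rwa [hn] at h
    _ = ENNReal.ofReal s⁻¹ * (∫⁻ t : ℝ, ‖H ((t : ℂ) + ((s ^ 2 : ℝ) : ℂ) * Complex.I)‖ₑ ^ 2)
        + ENNReal.ofReal (Real.pi / s) := by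
        rw [lintegral_add_right _ (by fun_prop), lintegral_const_mul' _ _ (by simp), ← h2,
          ofReal_integral_eq_lintegral_ofReal h1 (Eventually.of_forall fun t => by positivity)]
    _ ≤ _ := by gcongr

theorem enorm_integral_vertical_dslope_le {H : ℂ → ℂ} {x R Y : ℝ} (hY : 0 ≤ Y) (h0 : H x = 0)
    (hR : R ≠ x) :
    ‖∫ y in (0 : ℝ)..Y, dslope H x ((R : ℂ) + (y : ℂ) * Complex.I)‖ₑ ≤
      (∫⁻ y in Set.Ioc 0 Y, ‖H ((R : ℂ) + (y : ℂ) * Complex.I)‖ₑ ^ 2)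
        + ENNReal.ofReal (1 / (R - x) ^ 2) * ENNReal.ofReal Y := by
  rw [intervalIntegral.integral_of_le hY]
  refine (enorm_integral_le_lintegral_enorm _).trans ?_
  have hp : 0 < (R - x) ^ 2 := by
    have := sub_ne_zero.2 hR
    positivity
  calc _ ≤ ∫⁻ y in Set.Ioc 0 Y, (‖H ((R : ℂ) + (y : ℂ) * Complex.I)‖ₑ ^ 2
        + ENNReal.ofReal (1 / (R - x) ^ 2)) := by
        refine lintegral_mono fun y => ?_
        have hne : (R : ℂ) + (y : ℂ) * Complex.I ≠ x := by
          intro h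
          have := congrArg Complex.re h
          simp at this
          exact hR this
        have h := enorm_dslope_le hne h0 one_pos
        have hn : (R - x) ^ 2 ≤ ‖(R : ℂ) + (y : ℂ) * Complex.I - x‖ ^ 2 := by
          rw [Complex.sq_norm, Complex.normSq_apply]
          simp
          nlinarith [sq_nonneg y]
        refine h.trans ?_
        rw [inv_one, ENNReal.ofReal_one, one_mul]
        gcongr
    _ = _ := by
        rw [lintegral_add_right _ measurable_const]
        simp

/-- Cauchy's theorem for the upper half-plane: if `H` belongs to the Hardy space, is continuous up
to the real line and vanishes at the real point `x`, then `H t / (t - x)` has integral zero. -/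
theorem MemHardyTwo.integral_dslope_eq_zero {H : ℂ → ℂ} (hH : MemHardyTwo H) (hm : Measurable H)
    (hc : ContinuousOn H {z : ℂ | 0 ≤ z.im}) {x : ℝ} (hd : DifferentiableAt ℂ H x)
    (h0 : H x = 0) (hL : MemLp (fun t : ℝ => H t) 2) : ∫ t : ℝ, dslope H x t = 0 := by
  obtain ⟨hHd, C, hC⟩ := hH
  have hint := integrable_dslope hc hd h0 hL
  have hqc := continuousOn_dslope_of_differentiableAt hc hd
  have hqd : DifferentiableOn ℂ (dslope H x) {z : ℂ | 0 < z.im} :=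
    (differentiableOn_dslope_of_notMem (by simp)).2 hHd
  set J := ∫ t : ℝ, dslope H x t with hJ
  have hbound : ∀ s : ℝ, 0 < s →
      ‖J‖ₑ ≤ ENNReal.ofReal s⁻¹ * C + ENNReal.ofReal (Real.pi / s) := by
    intro s hs
    have hY : 0 < s ^ 2 := by positivity
    set Y := s ^ 2 with hYd
    set G : ℝ → ℝ≥0∞ := fun R =>
      ∫⁻ y in Set.Ioc 0 Y, ‖H ((R : ℂ) + (y : ℂ) * Complex.I)‖ₑ ^ 2 with hG
    have hmG : Measurable (Function.uncurry fun R y : ℝ =>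
        ‖H ((R : ℂ) + (y : ℂ) * Complex.I)‖ₑ ^ 2) := by
      refine (Measurable.enorm (hm.comp ?_)).pow_const 2
      exact Continuous.measurable (by fun_prop)
    have hGm : Measurable G := hmG.lintegral_prod_right'
    -- By Tonelli, the side integrals `G R` have total mass at most `C Y`, since each horizontal
    -- line contributes at most `C`.
    have hGfin : ∫⁻ R, G R ≠ ∞ := by
      have h1 : ∫⁻ R, G R = ∫⁻ y in Set.Ioc 0 Y, ∫⁻ R : ℝ,
          ‖H ((R : ℂ) + (y : ℂ) * Complex.I)‖ₑ ^ 2 :=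
        lintegral_lintegral_swap hmG.aemeasurable
      have h2 : ∫⁻ R, G R ≤ ∫⁻ _ in Set.Ioc 0 Y, (C : ℝ≥0∞) := by
        rw [h1]
        exact setLIntegral_mono' measurableSet_Ioc fun y hy => hC y hy.1
      refine ne_top_of_le_ne_top ?_ h2
      simp [ENNReal.mul_eq_top]
    refine ENNReal.le_of_forall_pos_le_add fun ε hε _ => ?_
    have hε3 : (0 : ℝ≥0∞) < (ε / 3 : ℝ≥0) := by
      rw [ENNReal.coe_pos]
      positivity
    have hbot : Tendsto (fun R : ℝ => ‖J - ∫ t in (-R)..R, dslope H x t‖ₑ) atTop (𝓝 0) := by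
      have := intervalIntegral_tendsto_integral hint tendsto_neg_atTop_atBot tendsto_id
      have h2 := (this.const_sub J).enorm
      rw [hJ, sub_self, enorm_zero] at h2
      exact h2
    have hside : Tendsto (fun R : ℝ =>
        ENNReal.ofReal (1 / (R - x) ^ 2) * ENNReal.ofReal Y
          + ENNReal.ofReal (1 / (-R - x) ^ 2) * ENNReal.ofReal Y) atTop (𝓝 0) := by
      have h1 : ∀ f : ℝ → ℝ, Tendsto (fun R => f R ^ 2) atTop atTop →
          Tendsto (fun R => ENNReal.ofReal (1 / f R ^ 2) * ENNReal.ofReal Y) atTop (𝓝 0) := by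
        intro f hf
        have h2 := ENNReal.tendsto_ofReal (hf.inv_tendsto_atTop)
        rw [ENNReal.ofReal_zero] at h2
        have h3 := ENNReal.Tendsto.mul_const (b := ENNReal.ofReal Y) h2
          (Or.inr ENNReal.ofReal_ne_top)
        simpa [one_div] using h3
      have ha := h1 (fun R => R - x)
        ((tendsto_pow_atTop two_ne_zero).comp (tendsto_atTop_add_const_right _ (-x) tendsto_id))
      have hb := h1 (fun R => -R - x) (by
        have : (fun R : ℝ => (-R - x) ^ 2) = fun R => (R + x) ^ 2 := by ext; ring
        rw [this]
        exact (tendsto_pow_atTop two_ne_zero).comp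
          (tendsto_atTop_add_const_right _ x tendsto_id))
      simpa using ha.add hb
    -- One `R` serves all three errors: the tail of `J` and the `1/(±R - x)²` terms are eventually
    -- small, while `G R + G (-R)` is small only frequently.
    obtain ⟨R, hR1, hR2, hR3, hR4, hR5⟩ := ((frequently_add_neg_lt hGm hGfin hε3.ne').and_eventually
      ((hbot.eventually_lt_const hε3).and ((hside.eventually_lt_const hε3).and
        ((eventually_gt_atTop |x|).and (eventually_gt_atTop 0))))).exists
    have hRx : R ≠ x := ((le_abs_self x).trans_lt hR4).ne'
    have hRx' : -R ≠ x := by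
      have := (neg_le_abs x).trans_lt hR4
      intro h
      linarith
    have hcauchy := Complex.integral_boundary_rect_eq_zero_of_continuousOn_of_differentiableOn
      (dslope H x) ((-R : ℝ) : ℂ) ((R : ℂ) + (Y : ℂ) * Complex.I)
      (hqc.mono (by
        intro z hz
        have := hz.2
        simp only [Set.mem_preimage, Complex.ofReal_im, Complex.add_im, Complex.mul_im,
          Complex.ofReal_re, Complex.I_im, Complex.I_re, mul_one, mul_zero, add_zero, zero_add,
          Set.uIcc_of_le hY.le] at this
        exact this.1))
      (hqd.mono (by
        intro z hz
        have := hz.2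
        simp only [Set.mem_preimage, Complex.ofReal_im, Complex.add_im, Complex.mul_im,
          Complex.ofReal_re, Complex.I_im, Complex.I_re, mul_one, mul_zero, add_zero, zero_add,
          min_eq_left hY.le] at this
        exact this.1))
    simp only [Complex.ofReal_im, Complex.add_im, Complex.mul_im, Complex.add_re, Complex.mul_re,
      Complex.ofReal_re, Complex.I_im, Complex.I_re, mul_one, mul_zero, add_zero, zero_add,
      sub_zero, Complex.ofReal_zero, zero_mul] at hcauchy
    set I₀ := ∫ t : ℝ in (-R)..R, dslope H x t
    set I₁ := ∫ t : ℝ in (-R)..R, dslope H x (t + Y * Complex.I) with hI₁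
    set I₂ := ∫ y : ℝ in (0 : ℝ)..Y, dslope H x (R + y * Complex.I) with hI₂
    set I₃ := ∫ y : ℝ in (0 : ℝ)..Y, dslope H x ((-R : ℝ) + y * Complex.I) with hI₃
    have hJe : J = (J - I₀) + I₁ + (-(Complex.I • I₂) + Complex.I • I₃) := by
      linear_combination hcauchy
    have b1 : ‖I₁‖ₑ ≤ ENNReal.ofReal s⁻¹ * C + ENNReal.ofReal (Real.pi / s) := by
      rw [hI₁, intervalIntegral.integral_of_le (by linarith)]
      exact (enorm_integral_le_lintegral_enorm _).trans ((setLIntegral_le_lintegral _ _).trans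
        (lintegral_enorm_dslope_le h0 hs (hC _ hY)))
    have b2 := enorm_integral_vertical_dslope_le hY.le h0 hRx
    have b3 := enorm_integral_vertical_dslope_le hY.le h0 hRx'
    calc ‖J‖ₑ = ‖(J - I₀) + I₁ + (-(Complex.I • I₂) + Complex.I • I₃)‖ₑ := congrArg _ hJe
      _ ≤ ‖J - I₀‖ₑ + ‖I₁‖ₑ + (‖I₂‖ₑ + ‖I₃‖ₑ) := by
        refine (enorm_add_le _ _).trans (add_le_add (enorm_add_le _ _)
          ((enorm_add_le _ _).trans ?_))
        have hI : ‖Complex.I‖ₑ = 1 := by simp [← ofReal_norm]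
        rw [enorm_neg, enorm_smul, enorm_smul, hI, one_mul, one_mul]
      _ ≤ (ε / 3 : ℝ≥0) + (ENNReal.ofReal s⁻¹ * C + ENNReal.ofReal (Real.pi / s))
          + ((ε / 3 : ℝ≥0) + (ε / 3 : ℝ≥0)) := by
        refine add_le_add (add_le_add hR2.le b1) ((add_le_add b2 b3).trans ?_)
        rw [add_add_add_comm]
        exact add_le_add hR1.le hR3.le
      _ = _ := by
        have : (ε : ℝ≥0∞) = (ε / 3 : ℝ≥0) + ((ε / 3 : ℝ≥0) + (ε / 3 : ℝ≥0)) := by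
          rw [← ENNReal.coe_add, ← ENNReal.coe_add]
          congr 1
          ring
        rw [this]
        ring
  have hlim : Tendsto (fun s : ℝ => ENNReal.ofReal s⁻¹ * C + ENNReal.ofReal (Real.pi / s)) atTop
      (𝓝 0) := by
    have h1 := ENNReal.tendsto_ofReal tendsto_inv_atTop_zero
    have h2 := ENNReal.tendsto_ofReal (tendsto_const_nhds (x := Real.pi).div_atTop tendsto_id)
    rw [ENNReal.ofReal_zero] at h1 h2
    have h3 := ENNReal.Tendsto.mul_const (b := (C : ℝ≥0∞)) h1 (Or.inr ENNReal.coe_ne_top)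
    simpa using h3.add h2
  have := ge_of_tendsto hlim ((eventually_gt_atTop 0).mono hbound)
  exact enorm_eq_zero.1 (le_zero_iff.1 this)

/-! ### The reproducing kernel at a real point -/

theorem Differentiable.sharp {f : ℂ → ℂ} (hf : Differentiable ℂ f) :
    Differentiable ℂ (sharp f) := fun z => by
  simpa [Function.comp_def] using! (hf (conj z)).conj_conj

theorem sharp_ofReal (f : ℂ → ℂ) (x : ℝ) : sharp f x = conj (f x) := by
  simp [sharp]

theorem sharp_sharp (f : ℂ → ℂ) : sharp (sharp f) = f := by
  ext z
  simp [sharp]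

theorem memHardyTwo_of_norm_sq_le {F : ℂ → ℂ} {C x : ℝ}
    (hF : DifferentiableOn ℂ F {z : ℂ | 0 < z.im})
    (h : ∀ z : ℂ, 0 < z.im → ‖F z‖ ^ 2 ≤ C * (1 + (z.re - x) ^ 2)⁻¹) : MemHardyTwo F := by
  refine ⟨hF, (∫ t : ℝ, C * (1 + (t - x) ^ 2)⁻¹).toNNReal, fun y hy => ?_⟩
  have hi := (integrable_inv_one_add_sub_sq x).const_mul C
  have hC : 0 ≤ C := by
    have := (sq_nonneg _).trans (h ((x : ℂ) + Complex.I) (by simp))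
    simpa using this
  change _ ≤ ENNReal.ofReal _
  rw [ofReal_integral_eq_lintegral_ofReal hi (Eventually.of_forall fun t => by positivity)]
  refine lintegral_mono fun t => ?_
  rw [← ofReal_norm, ← ENNReal.ofReal_pow (norm_nonneg _)]
  refine ENNReal.ofReal_le_ofReal ?_
  simpa using h ((t : ℂ) + (y : ℂ) * Complex.I) (by simpa using hy)

theorem normSq_sub_ofReal_add_I {z : ℂ} (hz : 0 ≤ z.im) (x : ℝ) :
    1 + (z.re - x) ^ 2 ≤ ‖z - x + Complex.I‖ ^ 2 := by
  rw [Complex.sq_norm, Complex.normSq_apply]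
  simp
  nlinarith

theorem sub_ofReal_add_I_ne_zero {z : ℂ} (hz : 0 ≤ z.im) (x : ℝ) : z - x + Complex.I ≠ 0 := by
  intro h
  have := normSq_sub_ofReal_add_I hz x
  rw [h, norm_zero] at this
  nlinarith [sq_nonneg (z.re - x)]

theorem norm_sq_I_div_le {z : ℂ} (hz : 0 ≤ z.im) (x : ℝ) :
    ‖Complex.I / (z - x + Complex.I)‖ ^ 2 ≤ 1 * (1 + (z.re - x) ^ 2)⁻¹ := by
  rw [norm_div, Complex.norm_I, div_pow, one_pow, one_mul, one_div]
  exact inv_anti₀ (by positivity) (normSq_sub_ofReal_add_I hz x)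

theorem differentiableOn_I_div (x : ℝ) :
    DifferentiableOn ℂ (fun z : ℂ => Complex.I / (z - x + Complex.I)) {z : ℂ | 0 ≤ z.im} :=
  DifferentiableOn.div (by fun_prop) (by fun_prop) fun _ hz => sub_ofReal_add_I_ne_zero hz x

namespace DeBranges

variable {E : HermiteBiehler}

/-- The involution `f ↦ f*` of `H(E)`. -/
def involution (f : DeBranges E) : DeBranges E :=
  ⟨sharp f, f.differentiable.sharp, (Subtype.property f).2.2, by
    rw [sharp_sharp]
    exact (Subtype.property f).2.1⟩

theorem involution_apply (f : DeBranges E) (z : ℂ) : f.involution z = sharp f z := rfl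

/-- The quotient `f / E`, corrected by a multiple of a Cauchy kernel so as to vanish at `x`. -/
noncomputable def vanishingQuotient (f : DeBranges E) (x : ℝ) (z : ℂ) : ℂ :=
  f z / E z - f x / E x * (Complex.I / (z - x + Complex.I))

theorem vanishingQuotient_self (f : DeBranges E) (x : ℝ) : f.vanishingQuotient x x = 0 := by
  simp [vanishingQuotient]

/-- The function `i / (z - x + i)` equals 1 at `x`, is square integrable on the line and belongs to
the Hardy space, so the corrected quotient meets every hypothesis of Cauchy's theorem. -/
theorem dslope_vanishingQuotient (f : DeBranges E) (x : ℝ) :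
    Integrable (fun t : ℝ => dslope (f.vanishingQuotient x) x t) ∧
      ∫ t : ℝ, dslope (f.vanishingQuotient x) x t = 0 := by
  have h0 := f.vanishingQuotient_self x
  have hm : Measurable (f.vanishingQuotient x) := by
    have h1 := f.differentiable.continuous.measurable
    have h2 := E.differentiable'.continuous.measurable
    unfold vanishingQuotient
    fun_prop
  have hc : ContinuousOn (f.vanishingQuotient x) {z : ℂ | 0 ≤ z.im} :=
    (f.differentiable.continuous.continuousOn.div E.differentiable'.continuous.continuousOn
      fun z hz => E.ne_zero_of_im_nonneg hz).sub
      ((differentiableOn_I_div x).continuousOn.const_mul (f x / E x))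
  have hd : DifferentiableAt ℂ (f.vanishingQuotient x) x :=
    ((f.differentiable _).div (E.differentiable' _) (E.ne_zero_real' x)).sub
      (((differentiableAt_const _).div (by fun_prop) (by simp)).const_mul _)
  have hH : MemHardyTwo (f.vanishingQuotient x) := by
    have h1 := (memHardyTwo_of_norm_sq_le ((differentiableOn_I_div x).mono fun z hz => le_of_lt (Set.mem_ofPred.1 hz))
      fun z hz => norm_sq_I_div_le (le_of_lt hz) x).const_mul (-(f x / E x))
    have h2 := (Subtype.property f).2.1.add h1
    convert! h2 using 2
    rw [vanishingQuotient]
    simp only [toFun]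
    ring
  have hL : MemLp (fun t : ℝ => f.vanishingQuotient x t) 2 := by
    have h1 : MemLp (fun t : ℝ => Complex.I / ((t : ℂ) - x + Complex.I)) 2 := by
      have hcI : Continuous fun t : ℝ => Complex.I / ((t : ℂ) - x + Complex.I) :=
        (differentiableOn_I_div x).continuousOn.comp_continuous Complex.continuous_ofReal
          fun t => by simp
      rw [memLp_two_iff_integrable_sq_norm hcI.aestronglyMeasurable]
      refine ((integrable_inv_one_add_sub_sq x).const_mul 1).mono'
        (hcI.norm.pow 2).aestronglyMeasurable (Eventually.of_forall fun t => ?_)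
      have := norm_sq_I_div_le (z := (t : ℂ)) (by simp) x
      rw [Real.norm_of_nonneg (by positivity)]
      simpa using this
    exact f.memLp_quotient.sub (h1.const_mul (f x / E x))
  exact ⟨integrable_dslope hc hd h0 hL, hH.integral_dslope_eq_zero hm hc hd h0 hL⟩

/-- The numerator of the reproducing kernel at a real point. -/
def kernelNum (E : HermiteBiehler) (x : ℝ) (z : ℂ) : ℂ :=
  conj (E x) * E z - E x * sharp E z

theorem kernelNum_self (x : ℝ) : kernelNum E x x = 0 := by
  rw [kernelNum, sharp_ofReal]
  ring

theorem differentiable_kernelNum (x : ℝ) : Differentiable ℂ (kernelNum E x) :=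
  (E.differentiable'.const_mul _).sub (E.differentiable'.sharp.const_mul _)

/-- The reproducing kernel of `H(E)` at a real point, as a function. -/
noncomputable def kernelFun (E : HermiteBiehler) (x : ℝ) (z : ℂ) : ℂ :=
  Complex.I / (2 * Real.pi) * dslope (kernelNum E x) x z

theorem kernelFun_of_ne {x : ℝ} {z : ℂ} (hz : z ≠ x) :
    kernelFun E x z = Complex.I / (2 * Real.pi) * (kernelNum E x z / (z - x)) := by
  rw [kernelFun, dslope_of_ne _ hz, slope_def_field, kernelNum_self, sub_zero]

theorem differentiable_kernelFun (x : ℝ) : Differentiable ℂ (kernelFun E x) := by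
  refine Differentiable.const_mul ?_ _
  rw [← differentiableOn_univ]
  exact (Complex.differentiableOn_dslope univ_mem).2 (differentiable_kernelNum x).differentiableOn

/-- The symmetry is visible off `x` and extends by continuity. It reduces the two Hardy conditions
on the kernel to one and makes the kernel real on the real line. -/
theorem sharp_kernelFun (x : ℝ) : sharp (kernelFun E x) = kernelFun E x := by
  refine Continuous.ext_on (dense_compl_singleton (x : ℂ))
    (differentiable_kernelFun x).sharp.continuous (differentiable_kernelFun x).continuous ?_
  intro z hz
  have hz' : conj z ≠ (x : ℂ) := by
    intro h
    apply hz
    have := congrArg conj h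
    simpa using this
  rw [kernelFun_of_ne hz, sharp, kernelFun_of_ne hz']
  simp only [kernelNum, sharp, map_mul, map_div₀, map_sub, Complex.conj_conj, Complex.conj_I,
    Complex.conj_ofReal, Complex.conj_ofNat]
  ring

theorem norm_kernelNum_le (x : ℝ) {z : ℂ} (hz : 0 < z.im) :
    ‖kernelNum E x z‖ ≤ 2 * ‖E x‖ * ‖E z‖ := by
  calc ‖kernelNum E x z‖ ≤ ‖conj (E x) * E z‖ + ‖E x * sharp E z‖ := norm_sub_le _ _
    _ = ‖E x‖ * ‖E z‖ + ‖E x‖ * ‖sharp E z‖ := by rw [norm_mul, norm_mul, Complex.norm_conj]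
    _ ≤ ‖E x‖ * ‖E z‖ + ‖E x‖ * ‖E z‖ := by
      gcongr
      exact (E.norm_sharp_lt' z hz).le
    _ = _ := by ring

theorem memHardyTwo_kernelFun_div (x : ℝ) : MemHardyTwo fun z => kernelFun E x z / E z := by
  have hc : ContinuousOn (fun z => kernelFun E x z / E z) {z : ℂ | 0 ≤ z.im} :=
    (differentiable_kernelFun x).continuous.continuousOn.div
      E.differentiable'.continuous.continuousOn fun z hz => E.ne_zero_of_im_nonneg hz
  have hcl : IsClosed {z : ℂ | 0 ≤ z.im} := isClosed_le continuous_const Complex.continuous_im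
  obtain ⟨M, hM⟩ := ((isCompact_closedBall (x : ℂ) 1).inter_right hcl).exists_bound_of_continuousOn
    (hc.mono Set.inter_subset_right)
  have hd : DifferentiableOn ℂ (fun z => kernelFun E x z / E z) {z : ℂ | 0 < z.im} :=
    (differentiable_kernelFun x).differentiableOn.div E.differentiable'.differentiableOn
      fun z hz => E.ne_zero_of_im_nonneg (le_of_lt hz)
  -- The term `2M²` covers the half-disc `‖z - x‖ ≤ 1`, where `1 + (Re z - x)² ≤ 2`; the term `2‖E
  -- x‖²` covers the rest, where the quotient is at most `‖E x‖ / ‖z - x‖` and `1 + (Re z - x)² ≤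
  -- 2‖z - x‖²`.
  refine memHardyTwo_of_norm_sq_le (C := 2 * M ^ 2 + 2 * ‖E x‖ ^ 2) (x := x) hd fun z hz => ?_
  have hpos : 0 < 1 + (z.re - x) ^ 2 := by positivity
  have hre : (z.re - x) ^ 2 ≤ ‖z - x‖ ^ 2 := by
    rw [Complex.sq_norm, Complex.normSq_apply]
    simp
    nlinarith [sq_nonneg z.im]
  rw [← div_eq_mul_inv, le_div_iff₀ hpos]
  by_cases h : ‖z - x‖ ≤ 1
  · have h1 := hM z ⟨by rwa [mem_closedBall_iff_norm], le_of_lt hz⟩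
    have h2 : ‖z - x‖ ^ 2 ≤ 1 := pow_le_one₀ (norm_nonneg _) h
    have h3 : ‖kernelFun E x z / E z‖ ^ 2 ≤ M ^ 2 := by gcongr
    have h4 : 1 + (z.re - x) ^ 2 ≤ 2 := by linarith
    calc _ ≤ M ^ 2 * 2 := by gcongr
      _ ≤ _ := by nlinarith [sq_nonneg ‖E x‖]
  · rw [not_le] at h
    have hne : z ≠ x := by
      intro hzx
      rw [hzx, sub_self, norm_zero] at h
      linarith
    have hEz : 0 < ‖E z‖ := norm_pos_iff.2 (E.ne_zero_of_im_nonneg (le_of_lt hz))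
    have h1 : ‖kernelFun E x z / E z‖ ≤ ‖E x‖ / ‖z - x‖ := by
      rw [kernelFun_of_ne hne, norm_div, norm_mul, norm_div, norm_div, Complex.norm_I, norm_mul,
        Complex.norm_ofNat, Complex.norm_real, Real.norm_of_nonneg Real.pi_pos.le]
      have hπ : 1 / (2 * Real.pi) ≤ 1 / 2 := by
        gcongr
        linarith [Real.pi_gt_three]
      calc _ ≤ 1 / 2 * (2 * ‖E x‖ * ‖E z‖ / ‖z - x‖) / ‖E z‖ := by
            gcongr
            exact norm_kernelNum_le x hz
        _ = _ := by field_simp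
    have h2 : 1 + (z.re - x) ^ 2 ≤ 2 * ‖z - x‖ ^ 2 := by nlinarith
    calc _ ≤ (‖E x‖ / ‖z - x‖) ^ 2 * (2 * ‖z - x‖ ^ 2) := by gcongr
      _ = 2 * ‖E x‖ ^ 2 := by
        have : ‖z - x‖ ≠ 0 := by positivity
        field_simp
      _ ≤ _ := by nlinarith [sq_nonneg M]

/-- The reproducing kernel of `H(E)` at a real point. -/
noncomputable def kernel (E : HermiteBiehler) (x : ℝ) : DeBranges E :=
  ⟨kernelFun E x, differentiable_kernelFun x, memHardyTwo_kernelFun_div x, by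
    rw [sharp_kernelFun]
    exact memHardyTwo_kernelFun_div x⟩

theorem kernel_apply (x : ℝ) (z : ℂ) : kernel E x z = kernelFun E x z := rfl

theorem conj_kernel_ofReal (x t : ℝ) : conj (kernel E x t) = kernel E x t := by
  rw [kernel_apply, ← sharp_ofReal, sharp_kernelFun]

/-- Dividing by `|E|² = E · conj E` splits the kernel into a part with `f / E` and a part with the
conjugate of `f* / E`. The two Cauchy kernels subtracted from them combine into a Poisson kernel of
integral `π`, which alone survives integration and produces `f x`. -/
theorem kernel_integrand_eq (f : DeBranges E) {x t : ℝ} (h : t ≠ x) :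
    conj (kernel E x t) * f t / ((‖E t‖ ^ 2 : ℝ) : ℂ) =
      -Complex.I / (2 * Real.pi) * (E x * dslope (f.vanishingQuotient x) x t
        - conj (E x) * conj (dslope (f.involution.vanishingQuotient x) x t))
      + f x / Real.pi * (((1 + (t - x) ^ 2)⁻¹ : ℝ) : ℂ) := by
  have hne : (t : ℂ) ≠ x := fun h' => h (Complex.ofReal_inj.1 h')
  have hu : (t : ℂ) - x ≠ 0 := sub_ne_zero.2 hne
  have hE : ((‖E t‖ ^ 2 : ℝ) : ℂ) = conj (E t) * E t := by
    rw [Complex.conj_mul']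
    push_cast
    rfl
  rw [conj_kernel_ofReal, kernel_apply, kernelFun_of_ne hne, hE, dslope_of_ne _ hne,
    dslope_of_ne _ hne, slope_def_field, slope_def_field, vanishingQuotient_self,
    vanishingQuotient_self, sub_zero, sub_zero]
  simp only [kernelNum, vanishingQuotient, involution_apply, sharp_ofReal, map_mul, map_div₀,
    map_sub, map_add, Complex.conj_conj, Complex.conj_I, Complex.conj_ofReal]
  push_cast
  have e1 := E.ne_zero_real' t
  have e2 := E.ne_zero_real' x
  have e3 : conj (E t) ≠ 0 := (map_ne_zero _).2 e1
  have e4 : conj (E x) ≠ 0 := (map_ne_zero _).2 e2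
  have e5 : (t : ℂ) - x + Complex.I ≠ 0 := sub_ofReal_add_I_ne_zero (by simp) x
  have e6 : (t : ℂ) - x + -Complex.I ≠ 0 := by
    have := (map_ne_zero (starRingEnd ℂ)).2 e5
    simpa using this
  have e7 : (1 + ((t : ℂ) - x) ^ 2)⁻¹ = ((t : ℂ) - x + Complex.I)⁻¹ * ((t : ℂ) - x + -Complex.I)⁻¹ := by
    rw [← mul_inv]
    congr 1
    linear_combination Complex.I_mul_I
  have e8 : ((t : ℂ) - x + Complex.I)⁻¹ + ((t : ℂ) - x + -Complex.I)⁻¹ =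
      2 * ((t : ℂ) - x) * (((t : ℂ) - x + Complex.I)⁻¹ * ((t : ℂ) - x + -Complex.I)⁻¹) := by
    field_simp
    ring
  rw [e7]
  simp only [div_eq_mul_inv _ ((t : ℂ) - x + Complex.I),
    div_eq_mul_inv _ ((t : ℂ) - x + -Complex.I)]
  -- The two inverses become atoms tied only by the partial fraction relation `e8`, so that clearing
  -- denominators leaves them alone.
  generalize ((t : ℂ) - x + Complex.I)⁻¹ = p at *
  generalize ((t : ℂ) - x + -Complex.I)⁻¹ = q at *
  generalize (t : ℂ) - x = u at *
  have hπ : (Real.pi : ℂ) ≠ 0 := Complex.ofReal_ne_zero.2 Real.pi_ne_zero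
  field_simp
  linear_combination (-(f x) * E t * conj (E t) * Complex.I ^ 2) * e8
    + (-2 * u * p * q * f x * E t * conj (E t)) * Complex.I_sq

theorem isReproducingKernel_kernel (x : ℝ) : IsReproducingKernel (x : ℂ) (kernel E x) := by
  intro f
  obtain ⟨i1, j1⟩ := f.dslope_vanishingQuotient x
  obtain ⟨i2, j2⟩ := f.involution.dslope_vanishingQuotient x
  have i2' : Integrable fun t : ℝ => conj (dslope (f.involution.vanishingQuotient x) x t) :=
    Complex.conjCLE.toContinuousLinearMap.integrable_comp i2
  have i3 : Integrable fun t : ℝ => (((1 + (t - x) ^ 2)⁻¹ : ℝ) : ℂ) :=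
    (integrable_inv_one_add_sub_sq x).ofReal
  have i4 : Integrable fun t : ℝ => E x * dslope (f.vanishingQuotient x) x t
      - conj (E x) * conj (dslope (f.involution.vanishingQuotient x) x t) :=
    (i1.const_mul _).sub (i2'.const_mul _)
  have hae : ∀ᵐ t : ℝ, t ≠ x := by simp [ae_iff]
  rw [inner_eq, integral_congr_ae (hae.mono fun t ht => kernel_integrand_eq f ht),
    integral_add (i4.const_mul _) (i3.const_mul _),
    integral_const_mul, integral_sub (i1.const_mul _) (i2'.const_mul _), integral_const_mul,
    integral_const_mul, integral_const_mul, j1, integral_conj, j2, integral_complex_ofReal,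
    integral_sub_right_eq_self (fun t : ℝ => (1 + t ^ 2)⁻¹), integral_univ_inv_one_add_sq]
  have hπ : (Real.pi : ℂ) ≠ 0 := Complex.ofReal_ne_zero.2 Real.pi_ne_zero
  simp [hπ]

theorem IsReproducingKernel.unique {w : ℂ} {K K' : DeBranges E} (h : IsReproducingKernel w K)
    (h' : IsReproducingKernel w K') : K = K' :=
  ext_inner_right ℂ fun f => (h f).symm.trans (h' f)

/-- A zero kernel, evaluated at `i`, would force `|E(i)| = |E*(i)|`, against the strict
Hermite–Biehler inequality. -/
theorem kernel_ne_zero (x : ℝ) : kernel E x ≠ 0 := by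
  intro h
  have h1 : kernelFun E x Complex.I = 0 := by rw [← kernel_apply, h, zero_apply]
  have hne : Complex.I ≠ x := by
    intro h
    simpa using congrArg Complex.im h
  rw [kernelFun_of_ne hne] at h1
  have h2 : kernelNum E x Complex.I = 0 := by
    simpa [Real.pi_ne_zero, sub_ne_zero.2 hne] using h1
  have h3 := congrArg norm (sub_eq_zero.1 h2)
  rw [norm_mul, norm_mul, Complex.norm_conj] at h3
  have h4 := mul_left_cancel₀ (norm_ne_zero_iff.2 (E.ne_zero_real' x)) h3
  exact (E.norm_sharp_lt' Complex.I (by simp)).ne' h4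

theorem kernel_self (x : ℝ) : kernel E x x = ((‖kernel E x‖ ^ 2 : ℝ) : ℂ) := by
  rw [isReproducingKernel_kernel x (kernel E x), inner_self_eq_norm_sq_to_K]
  push_cast
  rfl

end DeBranges

/-! ### Parseval's identity and the local expansion at a node -/

/-- Parseval's identity for an orthonormal family with dense span; the space need not be
complete. -/
theorem Orthonormal.hasSum_norm_inner_sq_of_dense {V : Type*} [NormedAddCommGroup V]
    [InnerProductSpace ℂ V] {ι : Type*} {v : ι → V} (hv : Orthonormal ℂ v)
    (hd : (Submodule.span ℂ (Set.range v)).topologicalClosure = ⊤) (x : V) :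
    HasSum (fun i => ‖⟪v i, x⟫_ℂ‖ ^ 2) (‖x‖ ^ 2) := by
  -- The isometric embedding in the completion preserves inner products and the density of the span,
  -- so Parseval's identity there restricts to `V`.
  let j : V →ₗᵢ[ℂ] UniformSpace.Completion V := UniformSpace.Completion.toComplₗᵢ
  have hv' : Orthonormal ℂ (j ∘ v) := hv.comp_linearIsometry j
  have hdense : Dense ((Submodule.span ℂ (Set.range v) : Submodule ℂ V) : Set V) :=
    Submodule.dense_iff_topologicalClosure_eq_top.2 hd
  have hj : DenseRange j := UniformSpace.Completion.denseRange_coe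
  have hd' : ⊤ ≤ (Submodule.span ℂ (Set.range (j ∘ v))).topologicalClosure := by
    rw [top_le_iff, ← Submodule.dense_iff_topologicalClosure_eq_top]
    have h1 := hj.dense_image j.continuous hdense
    have h2 : (Submodule.span ℂ (Set.range (j ∘ v)) : Set (UniformSpace.Completion V)) =
        j '' (Submodule.span ℂ (Set.range v) : Set V) := by
      rw [Set.range_comp]
      exact congrArg (fun s : Submodule ℂ _ => (s : Set (UniformSpace.Completion V)))
        (Submodule.map_span j.toLinearMap (Set.range v)).symm
    rwa [h2]
  have h := (HilbertBasis.mk hv' hd').hasSum_inner_mul_inner (j x) (j x)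
  rw [HilbertBasis.coe_mk] at h
  simp only [Function.comp_apply, LinearIsometry.inner_map_map] at h
  rw [← Complex.hasSum_ofReal]
  rw [inner_self_eq_norm_sq_to_K] at h
  convert! h using 1
  · ext i
    rw [← inner_conj_symm x (v i), Complex.conj_mul']
    push_cast
    rfl
  · push_cast
    rfl

/-- The difference factors as `((t - sin t)/t³) (1 + sin t/t) (sin t/t)⁻²`, with limit `1/6 · 2 ·
1`. -/
theorem tendsto_inv_sin_sq_sub_inv_sq :
    Tendsto (fun t : ℝ => 1 / Real.sin t ^ 2 - 1 / t ^ 2) (𝓝[≠] 0) (𝓝 (1 / 3)) := by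
  have hid : Tendsto (fun t : ℝ => t) (𝓝[≠] 0) (𝓝 0) := nhdsWithin_le_nhds
  have h1 : Tendsto (fun t : ℝ => Real.sin t / t) (𝓝[≠] 0) (𝓝 1) := by
    have := (Real.hasDerivAt_sin 0).tendsto_slope_zero
    simpa [div_eq_inv_mul] using this
  have h2 : Tendsto (fun t : ℝ => (t - Real.sin t) / t ^ 3) (𝓝[≠] 0) (𝓝 (1 / 6)) := by
    rw [← tendsto_sub_nhds_zero_iff]
    have hb : Tendsto (fun t : ℝ => |t| ^ 2 / 100) (𝓝[≠] 0) (𝓝 0) := by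
      simpa using (hid.abs.pow 2).div_const (100 : ℝ)
    refine squeeze_zero_norm' ?_ hb
    have hs : ∀ᶠ t : ℝ in 𝓝[≠] 0, |t| < 1 :=
      (hid.abs.eventually_lt_const (by simp))
    filter_upwards [hs, self_mem_nhdsWithin] with t ht ht0
    have ht0' : t ≠ 0 := ht0
    have hp : 0 < |t| := abs_pos.2 ht0'
    have hb := Real.sin_bound ht.le
    have he : (t - Real.sin t) / t ^ 3 - 1 / 6 = -(Real.sin t - (t - t ^ 3 / 6)) / t ^ 3 := by
      field_simp
      ring
    rw [he, Real.norm_eq_abs, abs_div, abs_neg, abs_pow, div_le_iff₀ (by positivity)]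
    calc _ ≤ _ := hb
      _ = _ := by ring
  have h3 := (h2.mul (h1.const_add 1)).mul ((h1.pow 2).inv₀ (by norm_num))
  have h4 : (1 / 6 * (1 + 1) * (1 ^ 2)⁻¹ : ℝ) = 1 / 3 := by norm_num
  rw [h4] at h3
  refine h3.congr' ?_
  have hs0 : ∀ᶠ t : ℝ in 𝓝[≠] 0, Real.sin t / t ≠ 0 := h1.eventually_ne one_ne_zero
  filter_upwards [hs0, self_mem_nhdsWithin] with t ht ht0
  have ht0' : t ≠ 0 := ht0
  have hs : Real.sin t ≠ 0 := fun h => ht (by simp [h])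
  field_simp
  ring

/-- With `θ = φ x - φ x₀` and `h = x - x₀`, insert `φ'(x)/θ²`. The part `φ'(x) (1/sin² θ - 1/θ²)`
tends to `a/3`. The rest is `(φ'(x) a h² - θ²) / (a h² θ²)`, whose numerator cancels up to order
`h³`; the `h⁴` coefficient `ac/6 - b²/4`, divided by `a³`, is the Schwarzian term. -/
theorem tendsto_deriv_div_sin_sq_sub {φ : ℝ → ℝ} (hφ : ContDiff ℝ 3 φ) {x₀ : ℝ}
    (h0 : 0 < deriv φ x₀) :
    Tendsto (fun x => deriv φ x / Real.sin (φ x - φ x₀) ^ 2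
        - 1 / ((x - x₀) ^ 2 * deriv φ x₀)) (𝓝[≠] x₀)
      (𝓝 (deriv φ x₀ / 3 + schwarzian φ x₀ / (6 * deriv φ x₀))) := by
  have hφ1 : ContDiff ℝ 2 (deriv φ) := by
    have : ContDiff ℝ (2 + 1) φ := by norm_num; exact hφ
    exact (contDiff_succ_iff_deriv.1 this).2.2
  have hφ2 : ContDiff ℝ 1 (deriv (deriv φ)) := by
    have : ContDiff ℝ (1 + 1) (deriv φ) := by norm_num; exact hφ1
    exact (contDiff_succ_iff_deriv.1 this).2.2
  set a := deriv φ x₀ with ha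
  set b := deriv (deriv φ) x₀ with hb
  set c := deriv (deriv (deriv φ)) x₀ with hc
  have hS : schwarzian φ x₀ = (c * a - b * b) / a ^ 2 - (b / a) ^ 2 / 2 := by
    have hd : HasDerivAt (fun t => deriv (deriv φ) t / deriv φ t) ((c * a - b * b) / a ^ 2) x₀ :=
      (hφ2.differentiable one_ne_zero x₀).hasDerivAt.fun_div
        (hφ1.differentiable two_ne_zero x₀).hasDerivAt h0.ne'
    rw [schwarzian, hd.deriv]
  have hid : Tendsto (fun x : ℝ => x - x₀) (𝓝[≠] x₀) (𝓝 0) := by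
    have : ContinuousAt (fun x : ℝ => x - x₀) x₀ := by fun_prop
    simpa using this.tendsto.mono_left (nhdsWithin_le_nhds (s := {x₀}ᶜ))
  have hr1 : Tendsto (fun x => (deriv φ x - (a + b * (x - x₀) + c / 2 * (x - x₀) ^ 2))
      / (x - x₀) ^ 2) (𝓝[≠] x₀) (𝓝 0) := by
    have h := taylor_tendsto (n := 2) convex_univ (Set.mem_univ x₀) hφ1.contDiffOn
    rw [nhdsWithin_univ] at h
    refine (h.mono_left nhdsWithin_le_nhds).congr fun x => ?_
    simp only [taylor_within_apply, Finset.sum_range_succ, Finset.range_zero, Finset.sum_empty,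
      iteratedDerivWithin_univ, iteratedDeriv_succ, iteratedDeriv_zero, smul_eq_mul, Nat.factorial]
    rw [← hb, ← hc, ← ha]
    push_cast
    ring
  have hr2 : Tendsto (fun x => (φ x - φ x₀ - (a * (x - x₀) + b / 2 * (x - x₀) ^ 2
      + c / 6 * (x - x₀) ^ 3)) / (x - x₀) ^ 3) (𝓝[≠] x₀) (𝓝 0) := by
    have h := taylor_tendsto (n := 3) convex_univ (Set.mem_univ x₀) hφ.contDiffOn
    rw [nhdsWithin_univ] at h
    refine (h.mono_left nhdsWithin_le_nhds).congr fun x => ?_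
    simp only [taylor_within_apply, Finset.sum_range_succ, Finset.range_zero, Finset.sum_empty,
      iteratedDerivWithin_univ, iteratedDeriv_succ, iteratedDeriv_zero, smul_eq_mul, Nat.factorial]
    rw [← hb, ← hc, ← ha]
    push_cast
    ring
  have hslope : Tendsto (fun x => (φ x - φ x₀) / (x - x₀)) (𝓝[≠] x₀) (𝓝 a) := by
    have := (hφ.differentiable (by norm_num) x₀).hasDerivAt.tendsto_slope
    refine this.congr fun x => ?_
    rw [slope_def_field]
  have hcont : Tendsto (deriv φ) (𝓝[≠] x₀) (𝓝 a) :=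
    (hφ1.continuous.tendsto x₀).mono_left nhdsWithin_le_nhds
  have hne : ∀ᶠ x in 𝓝[≠] x₀, φ x - φ x₀ ≠ 0 := by
    filter_upwards [hslope.eventually_ne h0.ne'] with x hx h
    simp [h] at hx
  have hθ : Tendsto (fun x => φ x - φ x₀) (𝓝[≠] x₀) (𝓝[≠] 0) := by
    refine tendsto_nhdsWithin_iff.2 ⟨?_, hne⟩
    have := (hφ.continuous.tendsto x₀).sub_const (φ x₀)
    rw [sub_self] at this
    exact this.mono_left nhdsWithin_le_nhds
  have hA := hcont.mul (tendsto_inv_sin_sq_sub_inv_sq.comp hθ)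
  set r1 := fun x => (deriv φ x - (a + b * (x - x₀) + c / 2 * (x - x₀) ^ 2)) / (x - x₀) ^ 2
    with hr1d
  set r2 := fun x => (φ x - φ x₀ - (a * (x - x₀) + b / 2 * (x - x₀) ^ 2
      + c / 6 * (x - x₀) ^ 3)) / (x - x₀) ^ 3 with hr2d
  -- This is exactly `(φ'(x) a h² - θ²) / h⁴` written through the Taylor remainders `r1` and `r2`,
  -- as `e3` confirms.
  have hN : Tendsto (fun x => (a * c / 6 - b ^ 2 / 4) - b * c / 6 * (x - x₀)
      - c ^ 2 / 36 * (x - x₀) ^ 2 + a * r1 x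
      - 2 * (a + b / 2 * (x - x₀) + c / 6 * (x - x₀) ^ 2) * r2 x - r2 x ^ 2 * (x - x₀) ^ 2)
      (𝓝[≠] x₀) (𝓝 ((a * c / 6 - b ^ 2 / 4) - b * c / 6 * 0
      - c ^ 2 / 36 * 0 ^ 2 + a * 0
      - 2 * (a + b / 2 * 0 + c / 6 * 0 ^ 2) * 0 - 0 ^ 2 * 0 ^ 2)) :=
    (((((hid.const_mul _).const_sub _).sub ((hid.pow 2).const_mul _)).add
      (hr1.const_mul a)).sub (((((hid.const_mul (b / 2)).const_add a).add
        ((hid.pow 2).const_mul (c / 6))).const_mul 2).mul hr2)).sub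
      ((hr2.pow 2).mul (hid.pow 2))
  have hB := hN.div ((hslope.pow 2).const_mul a) (by positivity)
  have hAB := hA.add hB
  have hlim : a * (1 / 3) + ((a * c / 6 - b ^ 2 / 4) - b * c / 6 * 0
      - c ^ 2 / 36 * 0 ^ 2 + a * 0
      - 2 * (a + b / 2 * 0 + c / 6 * 0 ^ 2) * 0 - 0 ^ 2 * 0 ^ 2) / (a * a ^ 2) =
      a / 3 + schwarzian φ x₀ / (6 * a) := by
    rw [hS]
    field_simp
    ring
  rw [hlim] at hAB
  refine hAB.congr' ?_
  filter_upwards [hne, self_mem_nhdsWithin] with x hx hx0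
  have hh : x - x₀ ≠ 0 := sub_ne_zero.2 hx0
  have e1 : deriv φ x = a + b * (x - x₀) + c / 2 * (x - x₀) ^ 2 + r1 x * (x - x₀) ^ 2 := by
    simp only [hr1d]
    field_simp
    ring
  have e2 : φ x - φ x₀ = a * (x - x₀) + b / 2 * (x - x₀) ^ 2
      + c / 6 * (x - x₀) ^ 3 + r2 x * (x - x₀) ^ 3 := by
    simp only [hr2d]
    field_simp
    ring
  simp only [Function.comp_apply, Pi.div_apply]
  have e3 : (a * c / 6 - b ^ 2 / 4) - b * c / 6 * (x - x₀)
      - c ^ 2 / 36 * (x - x₀) ^ 2 + a * r1 x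
      - 2 * (a + b / 2 * (x - x₀) + c / 6 * (x - x₀) ^ 2) * r2 x - r2 x ^ 2 * (x - x₀) ^ 2 =
      (deriv φ x * a * (x - x₀) ^ 2 - (φ x - φ x₀) ^ 2) / (x - x₀) ^ 4 := by
    rw [e1, e2]
    field_simp
    ring
  rw [e3]
  generalize deriv φ x = p
  generalize φ x - φ x₀ = θ at hx
  generalize x - x₀ = h at hh
  field_simp
  ring

/-! ### The kernel in terms of the phase -/

namespace IsPhaseFunction

open DeBranges

variable {E : HermiteBiehler} {φ : ℝ → ℝ}

/-- Near `x` the phase is `φ x - Im log (E t / E x)`: by continuity `|φ t - φ x| < π`, so the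
principal argument recovers the phase difference without a jump. -/
theorem contDiff (hφ : IsPhaseFunction E φ) : ContDiff ℝ 3 φ := by
  rw [contDiff_iff_contDiffAt]
  intro x
  have hE : ContDiff ℝ 3 fun t : ℝ => E t / E x :=
    (((E.differentiable'.contDiff (n := 3)).restrict_scalars ℝ).comp
      Complex.ofRealCLM.contDiff).div_const _
  have hlog : ContDiffAt ℝ 3 (fun t : ℝ => φ x - (Complex.log (E t / E x)).im) x := by
    refine contDiffAt_const.sub ?_
    have h1 : ContDiffAt ℝ 3 Complex.log (E x / E x) := by
      refine ContDiffAt.restrict_scalars ℝ (Complex.contDiffAt_log ?_)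
      rw [div_self (E.ne_zero_real' x)]
      exact Complex.one_mem_slitPlane
    exact Complex.imCLM.contDiff.contDiffAt.comp x (h1.comp x hE.contDiffAt)
  refine hlog.congr_of_eventuallyEq ?_
  have hclose : ∀ᶠ t in 𝓝 x, |φ t - φ x| < Real.pi := by
    have : ContinuousAt (fun t => |φ t - φ x|) x := (hφ.1.sub continuous_const).abs.continuousAt
    refine this.tendsto.eventually_lt_const ?_
    simpa using Real.pi_pos
  filter_upwards [hclose] with t ht
  rw [abs_lt] at ht
  have h1 : 0 < ‖E t‖ / ‖E x‖ :=
    div_pos (norm_pos_iff.2 (E.ne_zero_real' t)) (norm_pos_iff.2 (E.ne_zero_real' x))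
  have h2 : E t / E x =
      ((‖E t‖ / ‖E x‖ : ℝ) : ℂ) * Complex.exp (((-(φ t - φ x) : ℝ) : ℂ) * Complex.I) := by
    rw [hφ.2 t, hφ.2 x, mul_div_mul_comm, ← Complex.exp_sub]
    simp only [norm_mul, Complex.norm_real, norm_norm]
    have hn : ∀ y : ℝ, ‖Complex.exp (-(Complex.I * (φ y : ℂ)))‖ = 1 := by
      intro y
      rw [Complex.norm_exp]
      simp
    rw [hn, hn, mul_one, mul_one]
    push_cast
    congr 2
    ring
  rw [Complex.log_im, h2, Complex.arg_real_mul _ h1, Complex.arg_exp_mul_I,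
    toIocMod_eq_self _ |>.2 ⟨by linarith, by linarith⟩]
  ring

theorem kernel_of_ne (hφ : IsPhaseFunction E φ) {x t : ℝ} (h : t ≠ x) :
    kernel E x t =
      ((‖E x‖ * ‖E t‖ * Real.sin (φ t - φ x) / (Real.pi * (t - x)) : ℝ) : ℂ) := by
  have hne : (t : ℂ) ≠ x := fun h' => h (Complex.ofReal_inj.1 h')
  have hu : (t : ℂ) - x ≠ 0 := sub_ne_zero.2 hne
  have hπ : (Real.pi : ℂ) ≠ 0 := Complex.ofReal_ne_zero.2 Real.pi_ne_zero
  have hnum : kernelNum E x t =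
      ‖E x‖ * ‖E t‖ * (-2 * Complex.I * Complex.sin (φ t - φ x)) := by
    have e1 : Complex.exp (Complex.I * φ x) * Complex.exp (-(Complex.I * φ t)) =
        Complex.exp (-((φ t - φ x : ℂ) * Complex.I)) := by
      rw [← Complex.exp_add]
      congr 1
      ring
    have e2 : Complex.exp (-(Complex.I * φ x)) * Complex.exp (Complex.I * φ t) =
        Complex.exp ((φ t - φ x : ℂ) * Complex.I) := by
      rw [← Complex.exp_add]
      congr 1
      ring
    have e3 : ∀ y : ℝ, conj (E y) = ‖E y‖ * Complex.exp (Complex.I * φ y) := by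
      intro y
      conv_lhs => rw [hφ.2 y]
      rw [map_mul, Complex.conj_ofReal, ← Complex.exp_conj]
      simp
    have e4 : 2 * Complex.I * Complex.sin (φ t - φ x : ℂ) =
        Complex.exp ((φ t - φ x : ℂ) * Complex.I) - Complex.exp (-((φ t - φ x : ℂ) * Complex.I)) := by
      rw [Complex.sin, neg_mul]
      linear_combination (Complex.exp (-((φ t - φ x : ℂ) * Complex.I)) -
        Complex.exp ((φ t - φ x : ℂ) * Complex.I)) * Complex.I_sq
    have e5 : kernelNum E x t = ‖E x‖ * Complex.exp (Complex.I * φ x)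
          * (‖E t‖ * Complex.exp (-(Complex.I * φ t)))
        - ‖E x‖ * Complex.exp (-(Complex.I * φ x)) * (‖E t‖ * Complex.exp (Complex.I * φ t)) := by
      rw [kernelNum, sharp_ofReal, e3, e3, ← hφ.2 x, ← hφ.2 t]
    rw [e5]
    linear_combination (‖E x‖ * ‖E t‖ : ℂ) * (e1 - e2 + e4)
  rw [kernel_apply, kernelFun_of_ne hne, hnum]
  push_cast
  field_simp
  linear_combination (-(‖E x‖ * ‖E t‖ * Complex.sin (φ t - φ x)) : ℂ) * Complex.I_sq

/-- Both sides are limits of `kernel E x t` as `t → x`: by continuity it tends to `K_x(x) = ‖K_x‖²`,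
and by the sine formula to a derivative. -/
theorem norm_kernel_sq (hφ : IsPhaseFunction E φ) (x : ℝ) :
    ‖kernel E x‖ ^ 2 = ‖E x‖ ^ 2 * deriv φ x / Real.pi := by
  have h1 : Tendsto (fun t : ℝ => kernel E x t) (𝓝[≠] x)
      (𝓝 ((‖kernel E x‖ ^ 2 : ℝ) : ℂ)) := by
    rw [← kernel_self]
    have : Continuous fun t : ℝ => kernel E x t :=
      (kernel E x).differentiable.continuous.comp Complex.continuous_ofReal
    exact (this.tendsto x).mono_left nhdsWithin_le_nhds
  have h2 : Tendsto (fun t : ℝ =>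
      ((‖E x‖ * ‖E t‖ * Real.sin (φ t - φ x) / (Real.pi * (t - x)) : ℝ) : ℂ)) (𝓝[≠] x)
      (𝓝 ((‖E x‖ ^ 2 * deriv φ x / Real.pi : ℝ) : ℂ)) := by
    refine (Complex.continuous_ofReal.tendsto _).comp ?_
    have hd : HasDerivAt (fun t => Real.sin (φ t - φ x)) (deriv φ x) x := by
      have := ((hφ.contDiff.differentiable (by norm_num) x).hasDerivAt.sub_const (φ x)).sin
      simpa using this
    have hn : Tendsto (fun t : ℝ => ‖E t‖) (𝓝[≠] x) (𝓝 ‖E x‖) :=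
      ((E.differentiable'.continuous.comp Complex.continuous_ofReal).norm.tendsto x).mono_left
        nhdsWithin_le_nhds
    have h3 := ((hn.const_mul ‖E x‖).mul hd.tendsto_slope).div_const Real.pi
    rw [← sq] at h3
    refine h3.congr fun t => ?_
    rw [slope_def_field, sub_self, Real.sin_zero, sub_zero]
    by_cases h : t - x = 0
    · simp [h]
    · field_simp
  have h3 := tendsto_nhds_unique (h1.congr' ?_) h2
  · exact_mod_cast h3
  · filter_upwards [self_mem_nhdsWithin] with t ht
    exact hφ.kernel_of_ne ht

theorem deriv_pos (hφ : IsPhaseFunction E φ) (x : ℝ) : 0 < deriv φ x := by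
  have h := hφ.norm_kernel_sq x
  have h1 : 0 < ‖kernel E x‖ ^ 2 := by
    have := norm_pos_iff.2 (kernel_ne_zero (E := E) x)
    positivity
  have h2 : 0 < ‖E x‖ := norm_pos_iff.2 (E.ne_zero_real' x)
  rw [h] at h1
  have h3 : 0 < ‖E x‖ ^ 2 * deriv φ x := by
    simpa [Real.pi_ne_zero] using mul_pos h1 Real.pi_pos
  exact pos_of_mul_pos_right h3 (by positivity)

end IsPhaseFunction

/-! ### Orthonormal bases of normalized kernels -/

namespace IsPhaseFunction

open DeBranges

variable {E : HermiteBiehler} {φ : ℝ → ℝ} {ι : Type*} {ω : ι → ℝ} {k : ι → DeBranges E}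

theorem normalizedKernel_eq {w : ℝ} {f : DeBranges E} (hf : IsNormalizedKernel (w : ℂ) f) :
    f = ((‖kernel E w‖⁻¹ : ℝ) : ℂ) • kernel E w := by
  obtain ⟨K, hK, rfl⟩ := hf
  rw [hK.unique (isReproducingKernel_kernel w)]

theorem norm_inner_normalizedKernel_sq (hφ : IsPhaseFunction E φ) {w x : ℝ} (h : w ≠ x)
    {f : DeBranges E} (hf : IsNormalizedKernel (w : ℂ) f) :
    ‖⟪f, kernel E x⟫_ℂ‖ ^ 2 =
      ‖E x‖ ^ 2 * (Real.sin (φ w - φ x) ^ 2 / (Real.pi * (w - x) ^ 2 * deriv φ w)) := by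
  have hw : ‖E w‖ ≠ 0 := norm_ne_zero_iff.2 (E.ne_zero_real' w)
  have hd := (hφ.deriv_pos w).ne'
  have hwx := sub_ne_zero.2 h
  have hr : ⟪kernel E w, kernel E x⟫_ℂ = kernel E x w :=
    (isReproducingKernel_kernel w (kernel E x)).symm
  rw [normalizedKernel_eq hf, inner_smul_left, hr, Complex.conj_ofReal,
    hφ.kernel_of_ne h, norm_mul, Complex.norm_real, Complex.norm_real, mul_pow, Real.norm_eq_abs,
    Real.norm_eq_abs, sq_abs, sq_abs, inv_pow, hφ.norm_kernel_sq]
  field_simp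

theorem injective_of_orthonormal (hk : ∀ n, IsNormalizedKernel (ω n : ℂ) (k n))
    (ho : Orthonormal ℂ k) : Function.Injective ω := by
  intro m n h
  have h1 : k m = k n := by rw [normalizedKernel_eq (hk m), normalizedKernel_eq (hk n), h]
  exact ho.linearIndependent.injective h1

theorem sin_sub_eq_zero (hφ : IsPhaseFunction E φ)
    (hk : ∀ n, IsNormalizedKernel (ω n : ℂ) (k n)) (ho : Orthonormal ℂ k) {m n : ι} (h : m ≠ n) :
    Real.sin (φ (ω m) - φ (ω n)) = 0 := by
  have hω := (injective_of_orthonormal hk ho).ne h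
  have h1 : ⟪k m, kernel E (ω n)⟫_ℂ = 0 := by
    have h2 : ⟪k m, k n⟫_ℂ = 0 := ho.2 h
    rw [normalizedKernel_eq (hk n), inner_smul_right] at h2
    have h3 : ((‖kernel E (ω n)‖⁻¹ : ℝ) : ℂ) ≠ 0 :=
      Complex.ofReal_ne_zero.2 (inv_ne_zero (norm_ne_zero_iff.2 (kernel_ne_zero _)))
    exact (mul_eq_zero.1 h2).resolve_left h3
  have h4 := hφ.norm_inner_normalizedKernel_sq hω (hk m)
  rw [h1] at h4
  have hE := E.ne_zero_real' (ω n)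
  have hd := (hφ.deriv_pos (ω m)).ne'
  simpa [hE, hd, Real.pi_ne_zero, sub_ne_zero.2 hω] using h4

/-- Parseval's identity for the reproducing kernel at `x`. -/
theorem hasSum_sin_sq (hφ : IsPhaseFunction E φ)
    (hk : ∀ n, IsNormalizedKernel (ω n : ℂ) (k n)) (ho : Orthonormal ℂ k)
    (hd : (Submodule.span ℂ (Set.range k)).topologicalClosure = ⊤) {x : ℝ} (hx : ∀ n, ω n ≠ x) :
    HasSum (fun n => Real.sin (φ (ω n) - φ x) ^ 2 / ((ω n - x) ^ 2 * deriv φ (ω n)))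
      (deriv φ x) := by
  have h := ho.hasSum_norm_inner_sq_of_dense hd (kernel E x)
  simp only [fun n => hφ.norm_inner_normalizedKernel_sq (hx n) (hk n), hφ.norm_kernel_sq] at h
  have hE : ‖E x‖ ≠ 0 := norm_ne_zero_iff.2 (E.ne_zero_real' x)
  have h2 := h.mul_left (Real.pi / ‖E x‖ ^ 2)
  have e1 : Real.pi / ‖E x‖ ^ 2 * (‖E x‖ ^ 2 * deriv φ x / Real.pi) = deriv φ x := by
    field_simp
  rw [e1] at h2
  refine h2.congr_fun fun n => ?_
  have h3 := (hφ.deriv_pos (ω n)).ne'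
  have h4 := sub_ne_zero.2 (hx n)
  field_simp

/-- The sum over the other points, at a point `x` near `ω i`. -/
theorem hasSum_ne (hφ : IsPhaseFunction E φ)
    (hk : ∀ n, IsNormalizedKernel (ω n : ℂ) (k n)) (ho : Orthonormal ℂ k)
    (hd : (Submodule.span ℂ (Set.range k)).topologicalClosure = ⊤) (i : ι) {x : ℝ}
    (hx : ω i ≠ x) (hs : Real.sin (φ x - φ (ω i)) ≠ 0) :
    HasSum (fun n : {n : ι // n ≠ i} => 1 / ((x - ω n) ^ 2 * deriv φ (ω n)))
      (deriv φ x / Real.sin (φ x - φ (ω i)) ^ 2 - 1 / ((x - ω i) ^ 2 * deriv φ (ω i))) := by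
  have hne : ∀ n, ω n ≠ x := by
    intro n h
    by_cases hn : n = i
    · exact hx (hn ▸ h)
    · exact hs (h ▸ hφ.sin_sub_eq_zero hk ho hn)
  -- The phases at the nodes differ by zeros of the sine, where the cosine is `±1`; squaring removes
  -- the sign.
  have hsq : ∀ n, Real.sin (φ (ω n) - φ x) ^ 2 = Real.sin (φ x - φ (ω i)) ^ 2 := by
    intro n
    have h0 : Real.sin (φ (ω n) - φ (ω i)) = 0 := by
      by_cases hn : n = i
      · simp [hn]
      · exact hφ.sin_sub_eq_zero hk ho hn
    have h1 : φ (ω n) - φ x = (φ (ω n) - φ (ω i)) - (φ x - φ (ω i)) := by ring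
    have h2 := Real.sin_sq_add_cos_sq (φ (ω n) - φ (ω i))
    rw [h0] at h2
    rw [h1, Real.sin_sub, h0]
    linear_combination Real.sin (φ x - φ (ω i)) ^ 2 * h2
  have h := (hφ.hasSum_sin_sq hk ho hd hne).div_const (Real.sin (φ x - φ (ω i)) ^ 2)
  have h' : HasSum (fun n => 1 / ((x - ω n) ^ 2 * deriv φ (ω n)))
      (deriv φ x / Real.sin (φ x - φ (ω i)) ^ 2) := by
    refine h.congr_fun fun n => ?_
    have h3 := (hφ.deriv_pos (ω n)).ne'
    have h4 := sub_ne_zero.2 (hne n)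
    have h5 : (x - ω n) ^ 2 = (ω n - x) ^ 2 := by ring
    rw [hsq, h5]
    field_simp
  classical
  have h1 := h'.sub (hasSum_ite_eq i (1 / ((x - ω i) ^ 2 * deriv φ (ω i))))
  refine (hasSum_subtype_iff_indicator (s := {n | n ≠ i})
    (f := fun n => 1 / ((x - ω n) ^ 2 * deriv φ (ω n)))).2 (h1.congr_fun fun n => ?_)
  by_cases hn : n = i
  · subst hn
    simp
  · simp [hn]

end IsPhaseFunction

/-! ### Passage to the limit at the node -/

theorem mainTheorem8 (E : HermiteBiehler) (φ : ℝ → ℝ) (hφ : IsPhaseFunction E φ)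
    {ι : Type*} (ω : ι → ℝ) (hω : DeBranges.IsKernelBasis E ω) (k : ι) :
    HasSum (fun n : {n : ι // n ≠ k} =>
        deriv φ (ω k) / ((ω k - ω n) ^ 2 * deriv φ (ω n)))
      (deriv φ (ω k) ^ 2 / 3 + schwarzian φ (ω k) / 6) := by
  obtain ⟨e, he, ho, hd⟩ := hω
  have hpos := hφ.deriv_pos
  have hsin : ∀ᶠ x in 𝓝[≠] ω k, Real.sin (φ x - φ (ω k)) ≠ 0 := by
    have h1 : HasDerivAt (fun x => Real.sin (φ x - φ (ω k))) (deriv φ (ω k)) (ω k) := by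
      have := ((hφ.contDiff.differentiable (by norm_num) (ω k)).hasDerivAt.sub_const
        (φ (ω k))).sin
      simpa using this
    simpa using h1.eventually_ne (c := 0) (hpos (ω k)).ne'
  obtain ⟨δ, hδ, hball⟩ := Metric.eventually_nhds_iff.1 (eventually_nhdsWithin_iff.1 hsin)
  -- The function `sin (φ x - φ (ω k))` has no zero in the punctured `δ`-ball but vanishes at every
  -- other node, so the nodes cannot accumulate at `ω k`.
  have hsep : ∀ n : {n : ι // n ≠ k}, δ ≤ |ω n - ω k| := by
    intro n
    by_contra! h
    exact hball (by rwa [Real.dist_eq])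
      ((IsPhaseFunction.injective_of_orthonormal he ho).ne n.2)
      (hφ.sin_sub_eq_zero he ho n.2)
  set F : ℝ → {n : ι // n ≠ k} → ℝ := fun x n => 1 / ((x - ω n) ^ 2 * deriv φ (ω n)) with hF
  have hsum : ∀ x, x ≠ ω k → |x - ω k| < δ → HasSum (F x)
      (deriv φ x / Real.sin (φ x - φ (ω k)) ^ 2 - 1 / ((x - ω k) ^ 2 * deriv φ (ω k))) :=
    fun x hx hxd => hφ.hasSum_ne he ho hd k hx.symm (hball (by rwa [Real.dist_eq]) hx)
  -- Parseval's identity at the single point `ω k + δ/2` supplies the summable majorant.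
  have hbase : Summable (F (ω k + δ / 2)) := by
    refine (hsum _ (by linarith) ?_).summable
    rw [add_sub_cancel_left, abs_of_pos (by positivity)]
    linarith
  -- Here `|x - ω n| ≥ δ/2`, and `x` is within `δ` of the base point, so the base point is at
  -- distance at most `3 |x - ω n|` from `ω n`; the 9 is the square of this 3. The bound includes `x
  -- = ω k`, which later gives summability there.
  have hdom : ∀ x, |x - ω k| < δ / 2 → ∀ n, ‖F x n‖ ≤ 9 * F (ω k + δ / 2) n := by
    intro x hx n
    have h1 := hsep n
    have h2 : δ / 2 ≤ |x - ω n| := by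
      have := abs_sub_abs_le_abs_sub (ω n - ω k) (x - ω k)
      have h3 : |ω n - ω k - (x - ω k)| = |x - ω n| := by
        rw [← abs_neg]
        congr 1
        ring
      linarith
    have h3 : |ω k + δ / 2 - ω n| ≤ 3 * |x - ω n| := by
      have h4 : ω k + δ / 2 - ω n = (x - ω n) + (δ / 2 - (x - ω k)) := by ring
      have h5 : |δ / 2 - (x - ω k)| ≤ δ := by
        rw [abs_lt] at hx
        rw [abs_le]
        constructor <;> linarith
      rw [h4]
      linarith [abs_add_le (x - ω n) (δ / 2 - (x - ω k))]
    have h6 : (ω k + δ / 2 - ω n) ^ 2 ≤ 9 * (x - ω n) ^ 2 := by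
      rw [← sq_abs, ← sq_abs (x - ω n)]
      nlinarith [abs_nonneg (ω k + δ / 2 - ω n)]
    have h7 : 0 < (ω k + δ / 2 - ω n) ^ 2 := by
      have : ω k + δ / 2 - ω n ≠ 0 := by
        intro h
        have h8 : ω n - ω k = δ / 2 := by linarith
        rw [h8, abs_of_pos (by positivity)] at h1
        linarith
      positivity
    have h8 : 0 < (x - ω n) ^ 2 := by linarith
    have h9 := hpos (ω n)
    simp only [hF]
    rw [Real.norm_of_nonneg (by positivity), mul_one_div, div_le_div_iff₀ (by positivity)
      (by positivity)]
    nlinarith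
  have hlim : Tendsto (fun x => ∑' n, F x n) (𝓝[≠] ω k) (𝓝 (∑' n, F (ω k) n)) := by
    refine tendsto_tsum_of_dominated_convergence (hbase.mul_left 9) (fun n => ?_) ?_
    · have h1 : (ω k - ω n) ^ 2 * deriv φ (ω n) ≠ 0 := by
        have h2 : ω k - ω n ≠ 0 := by
          intro h
          have h3 := hsep n
          rw [abs_sub_comm, h, abs_zero] at h3
          linarith
        exact mul_ne_zero (pow_ne_zero 2 h2) (hpos _).ne'
      have h2 : ContinuousAt (fun x => F x n) (ω k) :=
        continuousAt_const.div (by fun_prop) h1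
      exact h2.tendsto.mono_left nhdsWithin_le_nhds
    · have h1 : ∀ᶠ x in 𝓝 (ω k), |x - ω k| < δ / 2 := Metric.ball_mem_nhds _ (half_pos hδ)
      exact (h1.filter_mono nhdsWithin_le_nhds).mono fun x hx => hdom x hx
  have hval : ∑' n, F (ω k) n =
      deriv φ (ω k) / 3 + schwarzian φ (ω k) / (6 * deriv φ (ω k)) := by
    refine tendsto_nhds_unique hlim
      ((tendsto_deriv_div_sin_sq_sub hφ.contDiff (hpos (ω k))).congr' ?_)
    have h1 : ∀ᶠ x in 𝓝 (ω k), |x - ω k| < δ := Metric.ball_mem_nhds _ hδ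
    filter_upwards [h1.filter_mono nhdsWithin_le_nhds, self_mem_nhdsWithin] with x hx hx0
    exact (hsum x hx0 hx).tsum_eq.symm
  have hsummable : Summable (F (ω k)) :=
    (hbase.mul_left 9).of_norm_bounded (hdom (ω k) (by simpa using half_pos hδ))
  have h := hsummable.hasSum.mul_left (deriv φ (ω k))
  rw [hval] at h
  have hne := (hpos (ω k)).ne'
  convert! h using 1
  · ext n
    simp only [hF]
    ring
  · field_simp
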